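/- **Setting.** Fix a first-order language of built-in predicate and function symbols with equality, and a disjoint set of user-defined predicate symbols. A built-in constraint is an atom $\mathit{true}$, $\mathit{false}$, $s=t$ or $r(t_1,\dots,t_n)$ with $r$ a built-in predicate; a user-defined constraint is an atom $p(t_1,\dots,t_n)$ with $p$ user-defined. The constraint theory $\mathcal{CT}$ is a set of coherent built-in sentences, i.e. sentences $\forall(C\to\exists\bar Z.\,D)$ with $C,D$ possibly empty conjunctions of built-in constraints. $\exists_{-\bar X}\varphi$ is the existential closure of $\varphi$ except for the variables $\bar X$; $\mathrm{fv}$ denotes free variables. A *rule* is $K\backslash H\Longleftrightarrow G\mid C,B$, where $K,H$ are multisets of user-defined constraints, not both empty, $G,C$ are conjunctions of built-in constraints and $B$ is a multiset of user-defined constraints. Its local variables are $\mathrm{lv}(r)=\mathrm{fv}(G,C,B)\setminus\mathrm{fv}(K,H)$, and its logical reading is $\forall\big((K\wedge G)\to(H\leftrightarrow\exists_{-\mathrm{fv}(K,H)}(G\wedge C\wedge B))\big)$. A *program* $\mathcal P$ is a finite set of rules; $\mathcal{CP}$ is $\mathcal{CT}$ together with the logical readings of the rules of $\mathcal P$. A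 *state* $\langle D;E;\bar X\rangle$ consists of a multiset $D$ of user-defined constraints, a conjunction $E$ of built-in constraints and a finite set $\bar X$ of (global) variables. It is an *answer* if $D=\emptyset$. $\Sigma$ is the set of states, $\Sigma_b$ the set of answers. The *abstract equivalence* $\equiv_a$ is the least equivalence relation on $\Sigma$ such that 1. $\langle C;\,Y{=}t\wedge D;\,\bar X\rangle\equiv_a\langle C[Y\backslash t];\,Y{=}t\wedge D;\,\bar X\rangle$; 2. $\langle C;\mathit{false};\bar X\rangle\equiv_a\langle D;\mathit{false};\bar X\rangle$; 3. $\langle C;D;\bar X\rangle\equiv_a\langle C;E;\bar X\rangle$ if $\mathcal{CT}\vDash\exists_{-\mathrm{fv}(C,\bar X)}D\leftrightarrow\exists_{-\mathrm{fv}(C,\bar X)}E$; 4. $\langle C;E;\bar X\rangle\equiv_a\langle C;E;\{Y\}\cup\bar X\rangle$ if $Y\notin\mathrm{fv}(C,E)$. The *abstract transition relation* $\to_a$ of $\mathcal P$ is the least relation such that - $\langle K,H,D;\,G\wedge E;\,\bar X\rangle\to_a\langle B,K,D;\,C\wedge G\wedge E;\,\bar X\rangle$ whenever $r=(K\backslash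 H\Longleftrightarrow G\mid C,B)$ is a variant, by a renaming of variables, of a rule of $\mathcal P$ whose local variables are fresh, i.e. $\mathrm{lv}(r)\cap(\bar X\cup\mathrm{fv}(D,E))=\emptyset$; - if $\sigma_1\equiv_a\sigma_1'\to_a\sigma_2'\equiv_a\sigma_2$, then $\sigma_1\to_a\sigma_2$. Let $\to_a^*$ be the transitive closure of ${\to_a}\cup{\equiv_a}$. The relation $\to_a$ is *confluent* if, whenever $\sigma\to_a^*\sigma_1$ and $\sigma\to_a^*\sigma_2$, there is $\sigma'$ with $\sigma_1\to_a^*\sigma'$ and $\sigma_2\to_a^*\sigma'$. A state $\sigma$ *has at least one answer* if $\sigma\to_a^*\tau$ for some $\tau\in\Sigma_b$. The *inductive semantics* of $\mathcal P$ is the least fixpoint $$\mu\mathcal X.\Big(\{\sigma\in\Sigma\mid\exists\sigma'\in\mathcal X,\ \sigma\to_a\sigma'\}\ \cup\ \big(\Sigma_b\setminus[\![\langle\emptyset;\mathit{false};\emptyset\rangle]\!]_a\big)\Big),$$ where $[\![\sigma]\!]_a$ is the $\equiv_a$-class of $\sigma$. **Theorem.** Let $\mathcal P$ be a program such that $\to_a$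 is confluent, and let $\langle D;E;\bar X\rangle$ be a state having at least one answer. Then $\langle D;E;\bar X\rangle$ belongs to the inductive semantics of $\mathcal P$ if and only if $\exists(D\wedge E)$ is satisfiable within $\mathcal{CP}$, i.e. $\mathcal{CP}\cup\{\exists(D\wedge E)\}$ has a model. -/

import Mathlib

/-!
Constraint Handling Rules: syntax, logical reading, equivalence-based abstract operational
semantics, and inductive transition system semantics.
-/

universe u v w

namespace CHR



/-- Variables. -/
abbrev Var : Type := ℕ

/-! ### First-order formulas with named variables -/

section Formulas

variable {L : FirstOrder.Language.{u, v}}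

/-- `∃ S. φ`: existential quantification over the finite set of variables `S`. -/
noncomputable def exBlock (S : Finset Var) (φ : L.Formula Var) : L.Formula Var :=
  FirstOrder.Language.Formula.iExs {x : Var // x ∈ S}
    (FirstOrder.Language.Formula.relabel
      (fun x : Var => if h : x ∈ S then Sum.inr (⟨x, h⟩ : {x : Var // x ∈ S}) else Sum.inl x) φ)

/-- The existential closure of `φ` with the exception of the variables in `X`. -/
noncomputable def exExcept (X : Finset Var) (φ : L.Formula Var) : L.Formula Var :=
  exBlock (FirstOrder.Language.BoundedFormula.freeVarFinset φ \ X) φ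

/-- The universal closure of `φ`. -/
noncomputable def allClosure (φ : L.Formula Var) : L.Sentence :=
  FirstOrder.Language.Formula.iAlls (FirstOrder.Language.BoundedFormula.freeVarFinset φ)
    (FirstOrder.Language.Formula.relabel Sum.inr (FirstOrder.Language.BoundedFormula.restrictFreeVar φ id))

end Formulas

/-! ### Built-in and user-defined constraints -/

/-- Atomic built-in constraints over the built-in language `L`. -/
inductive BuiltIn (L : FirstOrder.Language.{u, v}) : Type (max u v)
  | verum : BuiltIn L
  | falsum : BuiltIn L
  | eq (s t : L.Term Var) : BuiltIn L
  | rel {n : ℕ} (R : L.Relations n) (ts : Fin n → L.Term Var) : BuiltIn L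

namespace BuiltIn

variable {L : FirstOrder.Language.{u, v}}

/-- Free variables. -/
def fv : BuiltIn L → Finset Var
  | verum => ∅
  | falsum => ∅
  | eq s t => s.varFinset ∪ t.varFinset
  | rel _ ts => Finset.univ.biUnion fun i => (ts i).varFinset

/-- Renaming of variables. -/
def rename (ρ : Var → Var) : BuiltIn L → BuiltIn L
  | verum => verum
  | falsum => falsum
  | eq s t => eq (s.relabel ρ) (t.relabel ρ)
  | rel R ts => rel R fun i => (ts i).relabel ρ

/-- The constraint as a first-order formula. -/
def toFormula : BuiltIn L → L.Formula Var
  | verum => ⊤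
  | falsum => ⊥
  | eq s t => s.equal t
  | rel R ts => R.formula ts

end BuiltIn

/-- A (possibly empty) conjunction of built-in constraints, written as a list. -/
abbrev BConj (L : FirstOrder.Language.{u, v}) : Type (max u v) := List (BuiltIn L)

namespace BConj

variable {L : FirstOrder.Language.{u, v}}

/-- Free variables. -/
def fv (E : BConj L) : Finset Var := (List.map BuiltIn.fv E).foldr (· ∪ ·) ∅

/-- Renaming of variables. -/
def rename (ρ : Var → Var) (E : BConj L) : BConj L := List.map (BuiltIn.rename ρ) E

/-- The conjunction as a first-order formula. -/
def toFormula (E : BConj L) : L.Formula Var := (List.map BuiltIn.toFormula E).foldr (· ⊓ ·) ⊤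

end BConj

/-- A user-defined (CHR) constraint `p(t₁, …, tₙ)`, where `U n` is the set of user-defined
predicate symbols of arity `n` and the `tᵢ` are terms of the built-in language. -/
structure UserConstraint (L : FirstOrder.Language.{u, v}) (U : ℕ → Type w) : Type (max u w) where
  arity : ℕ
  pred : U arity
  args : Fin arity → L.Term Var

/-- The first-order language that has only the user-defined predicate symbols. -/
def userLanguage (U : ℕ → Type w) : FirstOrder.Language.{u, w} := ⟨fun _ => PEmpty, U⟩

/-- The language of built-in and user-defined constraints. -/
abbrev fullLanguage (L : FirstOrder.Language.{u, v}) (U : ℕ → Type w) : FirstOrder.Language.{u, max v w} :=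
  L.sum (userLanguage.{u, w} U)

section

variable {L : FirstOrder.Language.{u, v}} {U : ℕ → Type w}

namespace UserConstraint

/-- Free variables. -/
def fv (c : UserConstraint L U) : Finset Var := Finset.univ.biUnion fun i => (c.args i).varFinset

/-- Application of a substitution. -/
def subst (σ : Var → L.Term Var) (c : UserConstraint L U) : UserConstraint L U :=
  ⟨c.arity, c.pred, fun i => (c.args i).subst σ⟩

/-- Renaming of variables. -/
def rename (ρ : Var → Var) (c : UserConstraint L U) : UserConstraint L U :=
  ⟨c.arity, c.pred, fun i => (c.args i).relabel ρ⟩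

/-- The constraint as a first-order formula. -/
def toFormula (c : UserConstraint L U) : (fullLanguage L U).Formula Var :=
  FirstOrder.Language.Relations.formula (L := fullLanguage L U) (Sum.inr c.pred)
    fun i => FirstOrder.Language.LHom.sumInl.onTerm (c.args i)

end UserConstraint

/-- Free variables of a multiset of user-defined constraints. -/
def userFv (C : Multiset (UserConstraint L U)) : Finset Var := (C.map UserConstraint.fv).sup

/-- The conjunction of a multiset of user-defined constraints. -/
noncomputable def userConj (C : Multiset (UserConstraint L U)) : (fullLanguage L U).Formula Var :=
  (C.toList.map UserConstraint.toFormula).foldr (· ⊓ ·) ⊤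

/-- A built-in conjunction as a formula of the full language. -/
def builtInConj (U : ℕ → Type w) (E : BConj L) : (fullLanguage L U).Formula Var :=
  FirstOrder.Language.LHom.sumInl.onFormula E.toFormula

end

/-! ### Rules, programs and states -/

/-- A CHR rule `kept \ removed ⟺ guard | bodyBuiltIn, bodyUser`.  Its two heads are not both
empty.  (Rule names play no role here: a program is a set of rules.) -/
structure Rule (L : FirstOrder.Language.{u, v}) (U : ℕ → Type w) : Type (max u v w) where
  kept : Multiset (UserConstraint L U)
  removed : Multiset (UserConstraint L U)
  guard : BConj L
  bodyBuiltIn : BConj L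
  bodyUser : Multiset (UserConstraint L U)
  head_ne : kept + removed ≠ 0

/-- A CHR program: a finite set of rules. -/
abbrev Program (L : FirstOrder.Language.{u, v}) (U : ℕ → Type w) : Type (max u v w) := Finset (Rule L U)

/-- A CHR state `⟨store; builtIn; globals⟩`. -/
@[ext] structure State (L : FirstOrder.Language.{u, v}) (U : ℕ → Type w) : Type (max u v w) where
  store : Multiset (UserConstraint L U)
  builtIn : BConj L
  globals : Finset Var

section

variable {L : FirstOrder.Language.{u, v}} {U : ℕ → Type w}

namespace Rule

/-- Free variables of the heads. -/
def headFv (r : Rule L U) : Finset Var := userFv r.kept ∪ userFv r.removed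

/-- The local variables: those of guard and body that do not occur in the heads. -/
def localVars (r : Rule L U) : Finset Var :=
  (r.guard.fv ∪ r.bodyBuiltIn.fv ∪ userFv r.bodyUser) \ r.headFv

/-- The variant of a rule under a renaming of the variables. -/
def rename (ρ : Equiv.Perm Var) (r : Rule L U) : Rule L U where
  kept := r.kept.map (UserConstraint.rename ρ)
  removed := r.removed.map (UserConstraint.rename ρ)
  guard := r.guard.rename ρ
  bodyBuiltIn := r.bodyBuiltIn.rename ρ
  bodyUser := r.bodyUser.map (UserConstraint.rename ρ)
  head_ne := by
    rw [← Multiset.map_add]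
    exact fun h => r.head_ne (Multiset.map_eq_zero.mp h)

/-- The logical reading
`∀ ((kept ∧ guard) → (removed ↔ ∃_{-fv(heads)} (guard ∧ bodyBuiltIn ∧ bodyUser)))`. -/
noncomputable def reading (r : Rule L U) : (fullLanguage L U).Sentence :=
  allClosure
    ((userConj r.kept ⊓ builtInConj U r.guard).imp
      ((userConj r.removed).iff
        (exExcept r.headFv
          (builtInConj U r.guard ⊓ (builtInConj U r.bodyBuiltIn ⊓ userConj r.bodyUser)))))

end Rule

/-- The logical reading of a program within the constraint theory `CT`. -/
def programTheory (CT : L.Theory) (P : Program L U) : (fullLanguage L U).Theory :=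
  FirstOrder.Language.LHom.sumInl.onTheory CT ∪ Rule.reading '' (P : Set (Rule L U))

/-- A coherent sentence `∀ (C → ∃ Z. D)`, with `C`, `D` conjunctions of built-in constraints. -/
def IsCoherent (φ : L.Sentence) : Prop :=
  ∃ (C : BConj L) (Z : Finset Var) (D : BConj L),
    φ = allClosure (C.toFormula.imp (exBlock Z D.toFormula))

/-- A multiset of user-defined constraints `D` and a built-in conjunction `E` are such that
`∃ (D ∧ E)` is satisfiable within the logical reading of the program `P` and `CT`. -/
def SatisfiableWithin (CT : L.Theory) (P : Program L U)
    (D : Multiset (UserConstraint L U)) (E : BConj L) : Prop :=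
  (programTheory CT P ∪
    {FirstOrder.Language.Formula.exClosure (userConj D ⊓ builtInConj U E)}).IsSatisfiable

/-! ### Abstract equivalence and abstract transitions -/

/-- The clauses that generate the abstract equivalence. -/
inductive EquivClause (CT : L.Theory) : State L U → State L U → Prop
  | subst (C : Multiset (UserConstraint L U)) (Y : Var) (t : L.Term Var) (D : BConj L)
      (X : Finset Var) :
      EquivClause CT
        ⟨C, BuiltIn.eq (FirstOrder.Language.Term.var Y) t :: D, X⟩
        ⟨C.map (UserConstraint.subst (Function.update FirstOrder.Language.Term.var Y t)),
          BuiltIn.eq (FirstOrder.Language.Term.var Y) t :: D, X⟩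
  | inconsistent (C D : Multiset (UserConstraint L U)) (X : Finset Var) :
      EquivClause CT ⟨C, [BuiltIn.falsum], X⟩ ⟨D, [BuiltIn.falsum], X⟩
  | builtIn (C : Multiset (UserConstraint L U)) (D E : BConj L) (X : Finset Var)
      (h : CT ⊨ᵇ (exExcept (userFv C ∪ X) D.toFormula).iff
        (exExcept (userFv C ∪ X) E.toFormula)) :
      EquivClause CT ⟨C, D, X⟩ ⟨C, E, X⟩
  | globals (C : Multiset (UserConstraint L U)) (E : BConj L) (X : Finset Var) (Y : Var)
      (hY : Y ∉ userFv C ∪ E.fv) :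
      EquivClause CT ⟨C, E, X⟩ ⟨C, E, insert Y X⟩

/-- The abstract equivalence: the least equivalence relation closed under the clauses. -/
def AbstractEquiv (CT : L.Theory) : State L U → State L U → Prop :=
  Relation.EqvGen (EquivClause CT)

/-- The transition relation of `P` modulo an equivalence relation `eqv`.  A rule is applied in a
variant whose local variables are fresh, i.e. occur neither among the global variables nor in the
part of the state that the variant does not match. -/
inductive Step (P : Program L U) (eqv : State L U → State L U → Prop) :
    State L U → State L U → Prop
  | apply (r : Rule L U) (hr : r ∈ P) (ρ : Equiv.Perm Var)
      (D : Multiset (UserConstraint L U)) (E : BConj L) (X : Finset Var)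
      (hX : Disjoint (r.rename ρ).localVars X)
      (hfresh : Disjoint (r.rename ρ).localVars (userFv D ∪ E.fv)) :
      Step P eqv
        ⟨(r.rename ρ).kept + (r.rename ρ).removed + D, (r.rename ρ).guard ++ E, X⟩
        ⟨(r.rename ρ).bodyUser + (r.rename ρ).kept + D,
          (r.rename ρ).bodyBuiltIn ++ ((r.rename ρ).guard ++ E), X⟩
  | equiv {σ₁ σ₁' σ₂ σ₂' : State L U} (h₁ : eqv σ₁ σ₁') (h : Step P eqv σ₁' σ₂')
      (h₂ : eqv σ₂' σ₂) : Step P eqv σ₁ σ₂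

/-- The abstract transition relation. -/
def AbstractStep (CT : L.Theory) (P : Program L U) : State L U → State L U → Prop :=
  Step P (AbstractEquiv CT)

/-- The transitive closure of the union of abstract transition and abstract equivalence. -/
def AbstractSteps (CT : L.Theory) (P : Program L U) : State L U → State L U → Prop :=
  Relation.TransGen fun σ τ => AbstractStep CT P σ τ ∨ AbstractEquiv CT σ τ

/-- Confluence of the abstract transition relation. -/
def IsConfluent (CT : L.Theory) (P : Program L U) : Prop :=
  ∀ σ σ₁ σ₂ : State L U, AbstractSteps CT P σ σ₁ → AbstractSteps CT P σ σ₂ →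
    ∃ σ' : State L U, AbstractSteps CT P σ₁ σ' ∧ AbstractSteps CT P σ₂ σ'

/-! ### Inductive transition system semantics -/

/-- The set of answers: states with an empty CHR store. -/
def answers (L : FirstOrder.Language.{u, v}) (U : ℕ → Type w) : Set (State L U) := {σ | σ.store = 0}

/-- The state has at least one answer: some answer is accessible from it. -/
def HasAnswer (CT : L.Theory) (P : Program L U) (σ : State L U) : Prop :=
  ∃ τ ∈ answers L U, AbstractSteps CT P σ τ

/-- The inconsistent state `⟨∅; false; ∅⟩`. -/
def failure (L : FirstOrder.Language.{u, v}) (U : ℕ → Type w) : State L U := ⟨0, [BuiltIn.falsum], ∅⟩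

/-- The existential immediate cause operator. -/
def existentialCause (CT : L.Theory) (P : Program L U) (A : Set (State L U)) : Set (State L U) :=
  {σ | ∃ σ', AbstractStep CT P σ σ' ∧ σ' ∈ A}

/-- The monotone operator whose least fixpoint is the inductive semantics. -/
def inductiveOperator (CT : L.Theory) (P : Program L U) :
    Set (State L U) →o Set (State L U) where
  toFun A := existentialCause CT P A ∪ (answers L U \ {σ | AbstractEquiv CT (failure L U) σ})
  monotone' := by
    intro A B hAB σ hσ
    rcases hσ with ⟨σ', h, hA⟩ | h
    · exact Or.inl ⟨σ', h, hAB hA⟩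
    · exact Or.inr h

/-- The inductive (transition system) semantics of a program. -/
def inductiveSemantics (CT : L.Theory) (P : Program L U) : Set (State L U) :=
  OrderHom.lfp (inductiveOperator CT P)

end

end CHR

section

open FirstOrder FirstOrder.Language

namespace CHR

/-! ### Dependence on variables -/

section Syntactic

variable {L : FirstOrder.Language.{u, v}} {U : ℕ → Type w} {M : Type*} [L.Structure M]

/-! Everything is reduced to ground instances. `State.Sat Q v` says that some valuation agreeing
with `v` on the globals satisfies the built-ins and gives the store a ground instance with property
`Q`. In every model of the constraint theory this is invariant under abstract equivalence, so only
genuine rule applications need analysis.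

Satisfiability gives membership: in a model of the logical readings, a transition preserves the
truth of all atoms of an instance (`AbstractSteps.sat_atoms`). Hence the given answer is satisfiable
in that model, so it is not equivalent to failure, and the inductive semantics is closed under
predecessors.

For the converse, membership yields a derivation to an answer that is not failure, and the built-ins
of that answer hold in some model of the constraint theory. This model is expanded by declaring a
ground atom true when it is removable, that is, when it belongs to a multiset that ground rule
instances rewrite to the empty one. Reading the derivation backwards (`AbstractSteps.sat_vanishes`)
makes the initial state true. It remains to verify the readings of the rules
(`IsConfluent.removable_iff`). From body to head, a ground step is put in front of a vanishing
derivation. From head to body, one needs that applying a rule to a vanishing store leaves a store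
that can still vanish; this is `IsConfluent.sat_vanishes`, the only use of confluence.

Confluence concerns abstract states, whereas the vanishing derivation is ground. A ground step lifts
to an abstract step only after guards and equations have been added to the state
(`GroundStep.lift`). The competing abstract derivation must therefore be replayed from this more
instantiated state (`Simulates.of_steps`) before the two branches can be joined. -/

theorem term_realize_congr (t : L.Term Var) {v v' : Var → M}
    (h : ∀ x ∈ t.varFinset, v x = v' x) : t.realize v = t.realize v' := by
  rw [← Term.realize_restrictVar (t := t) (f := Subtype.val) (v := v) v (fun _ => rfl),
    Term.realize_restrictVar (t := t) (f := Subtype.val) (v := v) v' (fun a => h a a.2)]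

theorem formula_realize_congr (φ : L.Formula Var) {v v' : Var → M}
    (h : ∀ x ∈ BoundedFormula.freeVarFinset φ, v x = v' x) : φ.Realize v ↔ φ.Realize v' := by
  unfold Formula.Realize
  rw [← BoundedFormula.realize_restrictFreeVar (φ := φ) (f := Subtype.val) (v := v) v
      (fun _ => rfl),
    BoundedFormula.realize_restrictFreeVar (φ := φ) (f := Subtype.val) (v := v) v'
      (fun a => h a a.2)]

theorem varFinset_relabel (g : Var → Var) (t : L.Term Var) :
    (t.relabel g).varFinset = t.varFinset.image g := by
  induction t with
  | var => simp [Term.relabel, Term.varFinset]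
  | func f ts ih =>
    ext x
    simp only [Term.relabel, Term.varFinset, ih, Finset.mem_biUnion, Finset.mem_univ, true_and,
      Finset.mem_image]
    grind

theorem term_relabel_congr (t : L.Term Var) {g g' : Var → Var}
    (h : ∀ x ∈ t.varFinset, g x = g' x) : t.relabel g = t.relabel g' := by
  induction t with
  | var => simpa [Term.varFinset] using h
  | func f ts ih =>
    simp only [Term.relabel, Term.func.injEq, heq_eq_eq, true_and]
    funext i
    exact ih i fun x hx => h x (by
      simp only [Term.varFinset, Finset.mem_biUnion, Finset.mem_univ, true_and]; exact ⟨i, hx⟩)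

theorem term_subst_update_of_notMem (t s : L.Term Var) {y : Var} (h : y ∉ t.varFinset) :
    t.subst (Function.update Term.var y s) = t := by
  induction t with
  | var x =>
    have : x ≠ y := by simpa [Term.varFinset, eq_comm] using h
    simp [Term.subst, this]
  | func f ts ih =>
    simp only [Term.subst, Term.func.injEq, heq_eq_eq, true_and]
    funext i
    exact ih i fun hx => h (by
      simp only [Term.varFinset, Finset.mem_biUnion, Finset.mem_univ, true_and]; exact ⟨i, hx⟩)

/-! ### Existential closures -/

theorem realize_exBlock (S : Finset Var) (φ : L.Formula Var) (v : Var → M) :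
    (exBlock S φ).Realize v ↔ ∃ v' : Var → M, (∀ x ∉ S, v' x = v x) ∧ φ.Realize v' := by
  unfold exBlock
  rw [Formula.realize_iExs]
  simp only [Formula.realize_relabel]
  constructor
  · rintro ⟨i, hi⟩
    refine ⟨_, ?_, hi⟩
    intro x hx
    simp [hx]
  · rintro ⟨v', h, hv'⟩
    refine ⟨fun x => v' x, ?_⟩
    convert hv' using 1
    funext x
    by_cases hx : x ∈ S
    · simp [hx]
    · simp [hx, h x hx]

theorem realize_exExcept (X : Finset Var) (φ : L.Formula Var) (v : Var → M) :
    (exExcept X φ).Realize v ↔ ∃ v' : Var → M, (∀ x ∈ X, v' x = v x) ∧ φ.Realize v' := by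
  unfold exExcept
  rw [realize_exBlock]
  constructor
  · rintro ⟨v', h, hv'⟩
    exact ⟨v', fun x hx => h x (by simp [hx]), hv'⟩
  · rintro ⟨v', h, hv'⟩
    -- The block quantifies only free variables of `φ`, so `v'` is cut back to them; this does not
    -- affect the truth of `φ`.
    refine ⟨fun x => if x ∈ BoundedFormula.freeVarFinset φ \ X then v' x else v x,
      fun x hx => by simp only [hx, if_false], ?_⟩
    refine (formula_realize_congr φ fun x hx => ?_).1 hv'
    by_cases hX : x ∈ X
    · simp [hX, h x hX]
    · simp [hX, hx]

theorem realize_allClosure [Nonempty M] (φ : L.Formula Var) :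
    (allClosure φ).Realize M ↔ ∀ v : Var → M, φ.Realize v := by
  unfold allClosure Sentence.Realize
  rw [Formula.realize_iAlls]
  constructor
  · intro h v
    have := h fun a => v a
    rw [Formula.realize_relabel] at this
    exact (BoundedFormula.realize_restrictFreeVar (φ := φ) v (by simp)).1 this
  · intro h i
    let v : Var → M := fun x => if hx : x ∈ BoundedFormula.freeVarFinset φ then i ⟨x, hx⟩
      else Classical.arbitrary M
    rw [Formula.realize_relabel]
    exact (BoundedFormula.realize_restrictFreeVar (φ := φ) v (fun a => by simp [v])).2 (h v)

theorem realize_exClosure_iff [Nonempty M] (φ : L.Formula Var) :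
    (Formula.exClosure φ).Realize M ↔ ∃ v : Var → M, φ.Realize v := by
  rw [Formula.realize_exClosure]
  constructor
  · rintro ⟨i, hi⟩
    let v : Var → M := fun x => if hx : x ∈ BoundedFormula.freeVarFinset φ then i ⟨x, hx⟩
      else Classical.arbitrary M
    exact ⟨v, (BoundedFormula.realize_restrictFreeVar (φ := φ) v (fun a => by simp [v])).1 hi⟩
  · rintro ⟨v, hv⟩
    exact ⟨fun a => v a,
      (BoundedFormula.realize_restrictFreeVar (φ := φ) v (fun a => by simp)).2 hv⟩

/-! ### Semantics of built-in conjunctions -/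

/-- The built-in conjunction `E` holds under the valuation `v`. -/
def BConj.Holds (v : Var → M) (E : BConj L) : Prop := ∀ b ∈ E, b.toFormula.Realize v

theorem BConj.realize_toFormula (v : Var → M) (E : BConj L) :
    E.toFormula.Realize v ↔ E.Holds v := by
  unfold BConj.toFormula BConj.Holds Formula.Realize
  rw [BoundedFormula.realize_foldr_inf]
  simp

theorem BConj.holds_cons {v : Var → M} {b : BuiltIn L} {E : BConj L} :
    BConj.Holds v (b :: E) ↔ b.toFormula.Realize v ∧ E.Holds v := by
  simp [BConj.Holds]

theorem BConj.holds_append {v : Var → M} {E F : BConj L} :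
    BConj.Holds v (E ++ F) ↔ E.Holds v ∧ F.Holds v := by
  simp only [BConj.Holds, List.mem_append, or_imp, forall_and]

theorem BConj.holds_eq {v : Var → M} {s t : L.Term Var} :
    (BuiltIn.eq s t).toFormula.Realize v ↔ s.realize v = t.realize v := by
  simp [BuiltIn.toFormula]

theorem BConj.not_holds_falsum {v : Var → M} : ¬ BConj.Holds v ([BuiltIn.falsum] : BConj L) := by
  simp [BConj.Holds, BuiltIn.toFormula, Formula.Realize]

theorem BConj.mem_fv {E : BConj L} {x : Var} : x ∈ E.fv ↔ ∃ b ∈ E, x ∈ b.fv := by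
  unfold BConj.fv
  induction E with
  | nil => simp
  | cons b E ih => simp [ih]

theorem BuiltIn.realize_congr (b : BuiltIn L) {v v' : Var → M} (h : ∀ x ∈ b.fv, v x = v' x) :
    b.toFormula.Realize v ↔ b.toFormula.Realize v' := by
  cases b with
  | verum => simp [BuiltIn.toFormula, Formula.Realize]
  | falsum => simp [BuiltIn.toFormula, Formula.Realize]
  | eq s t =>
    rw [BConj.holds_eq, BConj.holds_eq,
      term_realize_congr s fun x hx => h x (Finset.mem_union_left _ hx),
      term_realize_congr t fun x hx => h x (Finset.mem_union_right _ hx)]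
  | rel R ts =>
    have : (fun i => (ts i).realize v) = fun i => (ts i).realize v' := funext fun i =>
      term_realize_congr (ts i) fun x hx => h x (by
        simp only [BuiltIn.fv, Finset.mem_biUnion, Finset.mem_univ, true_and]; exact ⟨i, hx⟩)
    simp only [BuiltIn.toFormula, Formula.realize_rel, this]

theorem BConj.holds_congr {E : BConj L} {v v' : Var → M} (h : ∀ x ∈ E.fv, v x = v' x) :
    E.Holds v ↔ E.Holds v' :=
  forall₂_congr fun b hb => b.realize_congr fun x hx => h x (BConj.mem_fv.2 ⟨b, hb, hx⟩)

theorem BuiltIn.realize_rename (b : BuiltIn L) (θ : Var → Var) (v : Var → M) :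
    (b.rename θ).toFormula.Realize v ↔ b.toFormula.Realize (v ∘ θ) := by
  cases b with
  | verum => simp [BuiltIn.rename, BuiltIn.toFormula, Formula.Realize]
  | falsum => simp [BuiltIn.rename, BuiltIn.toFormula, Formula.Realize]
  | eq s t => simp [BuiltIn.rename, BuiltIn.toFormula, Term.realize_relabel]
  | rel R ts =>
    simp only [BuiltIn.rename, BuiltIn.toFormula, Formula.realize_rel, Term.realize_relabel]

theorem BConj.holds_rename {E : BConj L} {θ : Var → Var} {v : Var → M} :
    (E.rename θ).Holds v ↔ E.Holds (v ∘ θ) := by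
  simp [BConj.Holds, BConj.rename, BuiltIn.realize_rename]

theorem BuiltIn.fv_rename (b : BuiltIn L) (θ : Var → Var) : (b.rename θ).fv = b.fv.image θ := by
  cases b with
  | verum => rfl
  | falsum => rfl
  | eq s t => simp [BuiltIn.rename, BuiltIn.fv, varFinset_relabel, Finset.image_union]
  | rel R ts =>
    ext x
    simp only [BuiltIn.rename, BuiltIn.fv, varFinset_relabel, Finset.mem_biUnion, Finset.mem_univ,
      true_and, Finset.mem_image]
    grind

theorem BConj.fv_rename (E : BConj L) (θ : Var → Var) : (E.rename θ).fv = E.fv.image θ := by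
  ext x
  simp only [BConj.mem_fv, Finset.mem_image, BConj.rename, List.mem_map]
  constructor
  · rintro ⟨_, ⟨b, hb, rfl⟩, hx⟩
    rw [BuiltIn.fv_rename, Finset.mem_image] at hx
    obtain ⟨y, hy, rfl⟩ := hx
    exact ⟨y, ⟨b, hb, hy⟩, rfl⟩
  · rintro ⟨y, ⟨b, hb, hy⟩, rfl⟩
    exact ⟨_, ⟨b, hb, rfl⟩, by rw [BuiltIn.fv_rename]; exact Finset.mem_image_of_mem _ hy⟩

theorem BConj.fv_append (E F : BConj L) : BConj.fv (E ++ F) = E.fv ∪ F.fv := by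
  ext x
  simp only [BConj.mem_fv, List.mem_append, Finset.mem_union]
  grind

theorem BConj.rename_append (E F : BConj L) (θ : Var → Var) :
    BConj.rename θ (E ++ F) = E.rename θ ++ F.rename θ := by
  simp [BConj.rename]

/-! ### Ground instances of user-defined constraints -/

/-- Ground atoms over the carrier `M`. -/
abbrev GroundAtom (U : ℕ → Type w) (M : Type*) := (n : ℕ) × (U n × (Fin n → M))

/-- The instance of a user-defined constraint under a valuation. -/
def UserConstraint.ground (v : Var → M) (c : UserConstraint L U) : GroundAtom U M :=
  ⟨c.arity, c.pred, fun i => (c.args i).realize v⟩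

/-- The instance of a multiset of user-defined constraints under a valuation. -/
def groundStore (v : Var → M) (C : Multiset (UserConstraint L U)) : Multiset (GroundAtom U M) :=
  C.map (UserConstraint.ground v)

theorem mem_userFv {C : Multiset (UserConstraint L U)} {x : Var} :
    x ∈ userFv C ↔ ∃ c ∈ C, x ∈ c.fv := by
  unfold userFv
  induction C using Multiset.induction_on with
  | empty => simp
  | cons c C ih => simp [ih]

theorem userFv_add (C D : Multiset (UserConstraint L U)) :
    userFv (C + D) = userFv C ∪ userFv D := by
  simp [userFv, Multiset.sup_add]

theorem UserConstraint.mem_fv {c : UserConstraint L U} {x : Var} :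
    x ∈ c.fv ↔ ∃ i, x ∈ (c.args i).varFinset := by
  simp [UserConstraint.fv]

theorem UserConstraint.fv_rename (c : UserConstraint L U) (θ : Var → Var) :
    (c.rename θ).fv = c.fv.image θ := by
  ext x
  simp only [UserConstraint.rename, UserConstraint.mem_fv, varFinset_relabel, Finset.mem_image]
  grind

theorem userFv_rename (C : Multiset (UserConstraint L U)) (θ : Var → Var) :
    userFv (C.map (UserConstraint.rename θ)) = (userFv C).image θ := by
  ext x
  simp only [mem_userFv, Multiset.mem_map, Finset.mem_image]
  constructor
  · rintro ⟨_, ⟨c, hc, rfl⟩, hx⟩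
    rw [UserConstraint.fv_rename, Finset.mem_image] at hx
    obtain ⟨y, hy, rfl⟩ := hx
    exact ⟨y, ⟨c, hc, hy⟩, rfl⟩
  · rintro ⟨y, ⟨c, hc, hy⟩, rfl⟩
    exact ⟨_, ⟨c, hc, rfl⟩, by rw [UserConstraint.fv_rename]; exact Finset.mem_image_of_mem _ hy⟩

theorem groundStore_congr {C : Multiset (UserConstraint L U)} {v v' : Var → M}
    (h : ∀ x ∈ userFv C, v x = v' x) : groundStore v C = groundStore v' C :=
  Multiset.map_congr rfl fun c hc => by
    have : (fun i => (c.args i).realize v) = fun i => (c.args i).realize v' := funext fun i =>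
      term_realize_congr _ fun x hx =>
        h x (mem_userFv.2 ⟨c, hc, UserConstraint.mem_fv.2 ⟨i, hx⟩⟩)
    simp only [UserConstraint.ground, this]

theorem groundStore_rename (C : Multiset (UserConstraint L U)) (θ : Var → Var) (v : Var → M) :
    groundStore v (C.map (UserConstraint.rename θ)) = groundStore (v ∘ θ) C := by
  simp [groundStore, UserConstraint.ground, UserConstraint.rename, Function.comp_def,
    Term.realize_relabel]
  rfl

theorem groundStore_add (C D : Multiset (UserConstraint L U)) (v : Var → M) :
    groundStore v (C + D) = groundStore v C + groundStore v D := Multiset.map_add _ _ _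

theorem groundStore_subst (C : Multiset (UserConstraint L U)) {y : Var} {t : L.Term Var}
    {v : Var → M} (h : v y = t.realize v) :
    groundStore v (C.map (UserConstraint.subst (Function.update Term.var y t))) =
      groundStore v C := by
  have : (fun a => (Function.update Term.var y t a).realize v) = v := by
    funext a
    by_cases ha : a = y
    · subst ha; simp [h]
    · simp [ha]
  simp [groundStore, UserConstraint.ground, UserConstraint.subst, Function.comp_def,
    Term.realize_subst, this]
  rfl

theorem store_rename_congr {C : Multiset (UserConstraint L U)} {θ θ' : Var → Var}
    (h : ∀ x ∈ userFv C, θ x = θ' x) :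
    C.map (UserConstraint.rename θ) = C.map (UserConstraint.rename θ') :=
  Multiset.map_congr rfl fun c hc => by
    have : (fun i => (c.args i).relabel θ) = fun i => (c.args i).relabel θ' := funext fun i =>
      term_relabel_congr _ fun x hx =>
        h x (mem_userFv.2 ⟨c, hc, UserConstraint.mem_fv.2 ⟨i, hx⟩⟩)
    simp only [UserConstraint.rename, this]

theorem store_rename_id (C : Multiset (UserConstraint L U)) :
    C.map (UserConstraint.rename id) = C := by
  conv_rhs => rw [← Multiset.map_id C]
  refine Multiset.map_congr rfl fun c _ => ?_
  simp [UserConstraint.rename, Term.relabel_id]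

theorem BConj.rename_id (E : BConj L) : E.rename id = E := by
  unfold BConj.rename
  conv_rhs => rw [← List.map_id E]
  refine List.map_congr_left fun b _ => ?_
  cases b <;> simp [BuiltIn.rename]

theorem store_subst_of_notMem {C : Multiset (UserConstraint L U)} {y : Var} (t : L.Term Var)
    (h : y ∉ userFv C) :
    C.map (UserConstraint.subst (Function.update Term.var y t)) = C := by
  conv_rhs => rw [← Multiset.map_id C]
  refine Multiset.map_congr rfl fun c hc => ?_
  have : (fun i => (c.args i).subst (Function.update Term.var y t)) = c.args := funext fun i =>
    term_subst_update_of_notMem _ _ fun hy =>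
      h (mem_userFv.2 ⟨c, hc, UserConstraint.mem_fv.2 ⟨i, hy⟩⟩)
  simp only [UserConstraint.subst, this, id]

/-- Any ground store is an instance of a store whose variables avoid a given finite set. -/
theorem exists_store_eq_ground (A : Multiset (GroundAtom U M)) (S : Finset Var) (v : Var → M) :
    ∃ (C : Multiset (UserConstraint L U)) (v' : Var → M), (∀ x ∈ S, v' x = v x) ∧
      Disjoint (userFv C) S ∧ groundStore v' C = A := by
  induction A using Multiset.induction_on generalizing S v with
  | empty => exact ⟨0, v, fun _ _ => rfl, by simp [userFv], rfl⟩
  | cons a A ih =>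
    obtain ⟨n, p, as⟩ := a
    -- `m` exceeds every element of `S`, so all `m + i` are fresh and can serve as the arguments of
    -- the new atom.
    let m := S.sup id + 1
    have hm : ∀ i, m + i ∉ S := fun i hi =>
      (Nat.lt_of_lt_of_le (Nat.lt_succ_self _) (Nat.le_add_right m i)).not_ge
        (Finset.le_sup (f := id) hi)
    let v₁ : Var → M := fun x => if h : m ≤ x ∧ x - m < n then as ⟨x - m, h.2⟩ else v x
    let c : UserConstraint L U := ⟨n, p, fun i => Term.var (m + i)⟩
    have hc : ∀ x, x ∈ c.fv ↔ ∃ i : Fin n, x = m + i := fun x => by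
      rw [UserConstraint.mem_fv]; simp [c, Term.varFinset]
    -- Protecting `c.fv` as well keeps the values that `v₁` has just given to the arguments of `c`.
    obtain ⟨C, v', h₁, h₂, h₃⟩ := ih (S ∪ c.fv) v₁
    refine ⟨c ::ₘ C, v', fun x hx => ?_, ?_, ?_⟩
    · rw [h₁ x (Finset.mem_union_left _ hx)]
      have : ¬ (m ≤ x ∧ x - m < n) := fun h => hm (x - m) (by rwa [Nat.add_sub_cancel' h.1])
      simp [v₁, this]
    · rw [Finset.disjoint_left]
      intro x hx hS
      rw [mem_userFv] at hx
      obtain ⟨d, hd, hx⟩ := hx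
      rcases Multiset.mem_cons.1 hd with rfl | hd
      · obtain ⟨i, rfl⟩ := (hc x).1 hx
        exact hm _ hS
      · exact Finset.disjoint_left.1 h₂ (mem_userFv.2 ⟨d, hd, hx⟩) (Finset.mem_union_left _ hS)
    · rw [groundStore, Multiset.map_cons]
      congr 1
      have : (fun i => (c.args i).realize v') = as := funext fun i => by
        change v' (m + i) = as i
        rw [h₁ _ (Finset.mem_union_right _ ((hc _).2 ⟨i, rfl⟩))]
        simp [v₁]
      exact Sigma.ext rfl (heq_of_eq (Prod.ext rfl this))

end Syntactic

/-! ### The abstract equivalence -/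

section Equivalence

variable {L : FirstOrder.Language.{u, v}} {U : ℕ → Type w} {CT : L.Theory}

/-- Some valuation that agrees with `v` on the global variables satisfies the built-in
constraints and gives the store an instance with the property `Q`. -/
def State.Sat {M : Type*} [L.Structure M] (Q : Multiset (GroundAtom U M) → Prop) (v : Var → M)
    (σ : State L U) : Prop :=
  ∃ v' : Var → M, (∀ x ∈ σ.globals, v' x = v x) ∧ σ.builtIn.Holds v' ∧
    Q (groundStore v' σ.store)

/-! ### Satisfaction as an invariant of abstract equivalence -/

theorem AbstractEquiv.refl (σ : State L U) : AbstractEquiv CT σ σ := Relation.EqvGen.refl _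

theorem AbstractEquiv.symm {σ τ : State L U} (h : AbstractEquiv CT σ τ) : AbstractEquiv CT τ σ :=
  Relation.EqvGen.symm _ _ h

theorem AbstractEquiv.trans {σ τ υ : State L U} (h : AbstractEquiv CT σ τ)
    (h' : AbstractEquiv CT τ υ) : AbstractEquiv CT σ υ := Relation.EqvGen.trans _ _ _ h h'

theorem EquivClause.sat_iff {M : Type*} [L.Structure M] [Nonempty M] [M ⊨ CT]
    {Q : Multiset (GroundAtom U M) → Prop} {σ τ : State L U} (h : EquivClause CT σ τ)
    (v : Var → M) : σ.Sat Q v ↔ τ.Sat Q v := by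
  cases h with
  | subst C Y t D X =>
    refine exists_congr fun v' => and_congr_right fun _ => and_congr_right fun h => ?_
    rw [groundStore_subst C (BConj.holds_eq.1 (BConj.holds_cons.1 h).1)]
  | inconsistent C D X =>
    exact exists_congr fun v' => and_congr_right fun _ =>
      ⟨fun h => absurd h.1 BConj.not_holds_falsum, fun h => absurd h.1 BConj.not_holds_falsum⟩
  | builtIn C D E X h =>
    have key : ∀ u : Var → M,
        (∃ u' : Var → M, (∀ x ∈ userFv C ∪ X, u' x = u x) ∧ D.Holds u') ↔
        (∃ u' : Var → M, (∀ x ∈ userFv C ∪ X, u' x = u x) ∧ E.Holds u') := fun u => by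
      -- Entailment by `CT` quantifies over models in one fixed universe; this transfers it to
      -- models in any universe, which the models of the full language require.
      have := h.realize_formula M (v := u)
      rw [Formula.realize_iff, realize_exExcept, realize_exExcept] at this
      simpa only [BConj.realize_toFormula] using this
    constructor
    · rintro ⟨v', h₁, h₂, h₃⟩
      obtain ⟨u, hu, hE⟩ := (key v').1 ⟨v', fun _ _ => rfl, h₂⟩
      refine ⟨u, fun x hx => (hu x (Finset.mem_union_right _ hx)).trans (h₁ x hx), hE, ?_⟩
      rwa [groundStore_congr fun x hx => hu x (Finset.mem_union_left _ hx)]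
    · rintro ⟨v', h₁, h₂, h₃⟩
      obtain ⟨u, hu, hE⟩ := (key v').2 ⟨v', fun _ _ => rfl, h₂⟩
      refine ⟨u, fun x hx => (hu x (Finset.mem_union_right _ hx)).trans (h₁ x hx), hE, ?_⟩
      rwa [groundStore_congr fun x hx => hu x (Finset.mem_union_left _ hx)]
  | globals C E X Y hY =>
    constructor
    · rintro ⟨v', h₁, h₂, h₃⟩
      -- As `Y` occurs neither in the store nor in the built-ins, its value can be reset to the one
      -- prescribed for the new global.
      have hu : ∀ x, x ≠ Y → Function.update v' Y (v Y) x = v' x := fun x hx => by simp [hx]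
      refine ⟨Function.update v' Y (v Y), fun x hx => ?_,
        (BConj.holds_congr fun x hx => hu x ?_).2 h₂, ?_⟩
      · by_cases hxY : x = Y
        · simp [hxY]
        · rw [hu x hxY]
          exact h₁ x (Finset.mem_of_mem_insert_of_ne hx hxY)
      · rintro rfl; exact hY (Finset.mem_union_right _ hx)
      · change Q (groundStore _ C)
        rwa [groundStore_congr fun x hx => hu x ?_]
        rintro rfl; exact hY (Finset.mem_union_left _ hx)
    · rintro ⟨v', h₁, h⟩
      exact ⟨v', fun x hx => h₁ x (Finset.mem_insert_of_mem hx), h⟩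

theorem AbstractEquiv.sat_iff {M : Type*} [L.Structure M] [Nonempty M] [M ⊨ CT]
    {Q : Multiset (GroundAtom U M) → Prop} {σ τ : State L U} (h : AbstractEquiv CT σ τ)
    (v : Var → M) : σ.Sat Q v ↔ τ.Sat Q v := by
  induction h with
  | rel _ _ h => exact h.sat_iff v
  | refl _ => rfl
  | symm _ _ _ ih => exact ih.symm
  | trans _ _ _ _ _ ih₁ ih₂ => exact ih₁.trans ih₂

/-- Entailment of built-in conjunctions within the constraint theory. -/
def Entails (CT : L.Theory) (E F : BConj L) : Prop :=
  ∀ (N : Theory.ModelType.{u, v, max u v} CT) (a : Var → N), E.Holds a → F.Holds a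

theorem Entails.holds {M : Type (max u v)} [L.Structure M] [Nonempty M] [M ⊨ CT] {E F : BConj L}
    (h : Entails CT E F) {a : Var → M} (hE : E.Holds a) : F.Holds a :=
  h (Theory.ModelType.of CT M) a hE

/-- A model-theoretic criterion for the built-in clause: existential closures agree when each
solution of one side can be altered, off the store variables and the globals, into a solution of the
other. -/
theorem AbstractEquiv.of_semantic {C : Multiset (UserConstraint L U)} {D E : BConj L}
    {X : Finset Var}
    (h₁ : ∀ (N : Theory.ModelType.{u, v, max u v} CT) (a : Var → N), D.Holds a →
      ∃ b : Var → N, (∀ x ∈ userFv C ∪ X, b x = a x) ∧ E.Holds b)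
    (h₂ : ∀ (N : Theory.ModelType.{u, v, max u v} CT) (a : Var → N), E.Holds a →
      ∃ b : Var → N, (∀ x ∈ userFv C ∪ X, b x = a x) ∧ D.Holds b) :
    AbstractEquiv CT ⟨C, D, X⟩ ⟨C, E, X⟩ := by
  refine .rel _ _ (.builtIn C D E X fun N a xs => ?_)
  rw [BoundedFormula.realize_iff, Subsingleton.elim xs default]
  change (exExcept _ _).Realize a ↔ (exExcept _ _).Realize a
  rw [realize_exExcept, realize_exExcept]
  simp only [BConj.realize_toFormula]
  constructor
  · rintro ⟨b, hb, hD⟩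
    obtain ⟨c, hc, hE⟩ := h₁ N b hD
    exact ⟨c, fun x hx => (hc x hx).trans (hb x hx), hE⟩
  · rintro ⟨b, hb, hD⟩
    obtain ⟨c, hc, hE⟩ := h₂ N b hD
    exact ⟨c, fun x hx => (hc x hx).trans (hb x hx), hE⟩

theorem AbstractEquiv.of_entails {C : Multiset (UserConstraint L U)} {D E : BConj L}
    {X : Finset Var} (h₁ : Entails CT D E) (h₂ : Entails CT E D) :
    AbstractEquiv CT ⟨C, D, X⟩ ⟨C, E, X⟩ :=
  .of_semantic (fun N a h => ⟨a, fun _ _ => rfl, h₁ N a h⟩)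
    (fun N a h => ⟨a, fun _ _ => rfl, h₂ N a h⟩)

/-- Built-in constraints that can be satisfied by changing the values of fresh variables only
may be added. -/
theorem AbstractEquiv.add_builtIn {C : Multiset (UserConstraint L U)} {D E : BConj L}
    {X : Finset Var} (hE : Entails CT E D)
    (h : ∀ (N : Theory.ModelType.{u, v, max u v} CT) (a : Var → N), D.Holds a →
      ∃ b : Var → N, (∀ x ∈ userFv C ∪ X, b x = a x) ∧ E.Holds b) :
    AbstractEquiv CT ⟨C, D, X⟩ ⟨C, E, X⟩ :=
  .of_semantic h (fun N a h => ⟨a, fun _ _ => rfl, hE N a h⟩)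

/-! ### Replacing provably equal terms in the store -/

theorem AbstractEquiv.subst_cons {C : Multiset (UserConstraint L U)} {n : ℕ} (p : U n)
    (ts : Fin n → L.Term Var) (i : Fin n) (t : L.Term Var) {E : BConj L} {X : Finset Var}
    {y : Var} (hC : y ∉ userFv C) (hts : ∀ j, y ∉ (ts j).varFinset) :
    AbstractEquiv CT
      ⟨⟨n, p, Function.update ts i (Term.var y)⟩ ::ₘ C, .eq (Term.var y) t :: E, X⟩
      ⟨⟨n, p, Function.update ts i t⟩ ::ₘ C, .eq (Term.var y) t :: E, X⟩ := by
  have := EquivClause.subst (CT := CT) (⟨n, p, Function.update ts i (Term.var y)⟩ ::ₘ C) y t E X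
  rw [Multiset.map_cons, store_subst_of_notMem t hC] at this
  have h : (fun j => (Function.update ts i (Term.var y) j).subst
      (Function.update Term.var y t)) = Function.update ts i t := by
    funext j
    by_cases hj : j = i
    · subst hj; simp [Term.subst]
    · simp [hj, term_subst_update_of_notMem _ _ (hts j)]
  simp only [UserConstraint.subst, h] at this
  exact .rel _ _ this

/-- The substitution clause exchanges only a variable and a term equated with it. A fresh `y`
therefore serves as an intermediate name: it is equated with `s`, put in the place of `s`, then
equated with `t` and replaced by `t`. Since `y` occurs nowhere else, the global substitution changes
this one argument only. -/
theorem AbstractEquiv.update_arg (C : Multiset (UserConstraint L U)) {n : ℕ} (p : U n)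
    (ts : Fin n → L.Term Var) (i : Fin n) {s t : L.Term Var} {E : BConj L} (X : Finset Var)
    (h : Entails CT E [.eq s t]) :
    AbstractEquiv CT ⟨⟨n, p, Function.update ts i s⟩ ::ₘ C, E, X⟩
      ⟨⟨n, p, Function.update ts i t⟩ ::ₘ C, E, X⟩ := by
  obtain ⟨y, hy⟩ := Infinite.exists_notMem_finset
    (userFv C ∪ (Finset.univ.biUnion fun j => (ts j).varFinset) ∪ s.varFinset ∪ t.varFinset ∪
      E.fv ∪ X)
  simp only [Finset.mem_union, Finset.mem_biUnion, Finset.mem_univ, true_and, not_or,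
    not_exists] at hy
  obtain ⟨⟨⟨⟨⟨hC, hts⟩, hs⟩, ht⟩, hE⟩, hX⟩ := hy
  have add : ∀ r : L.Term Var, y ∉ r.varFinset →
      AbstractEquiv CT ⟨⟨n, p, Function.update ts i r⟩ ::ₘ C, E, X⟩
        ⟨⟨n, p, Function.update ts i r⟩ ::ₘ C, .eq (Term.var y) r :: E, X⟩ := fun r hr => by
    refine .add_builtIn (fun N a h => (BConj.holds_cons.1 h).2) fun N a ha => ?_
    have hb : ∀ x, x ≠ y → Function.update a y (r.realize a) x = a x := fun x hx => by simp [hx]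
    refine ⟨Function.update a y (r.realize a), fun x hx => hb x ?_, BConj.holds_cons.2 ⟨?_,
      (BConj.holds_congr fun x hx => hb x ?_).2 ha⟩⟩
    · rintro rfl
      rcases Finset.mem_union.1 hx with hx | hx
      · obtain ⟨d, hd, hx⟩ := mem_userFv.1 hx
        rcases Multiset.mem_cons.1 hd with rfl | hd
        · obtain ⟨j, hj⟩ := UserConstraint.mem_fv.1 hx
          by_cases hji : j = i
          · rw [hji] at hj; simp [hr] at hj
          · simp [hji, hts j] at hj
        · exact hC (mem_userFv.2 ⟨d, hd, hx⟩)
      · exact hX hx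
    · rw [BConj.holds_eq, term_realize_congr r (v' := a) fun x hx => hb x ?_]
      · simp
      · rintro rfl; exact hr hx
    · rintro rfl; exact hE hx
  refine (add s hs).trans ((AbstractEquiv.subst_cons p ts i s hC hts).symm.trans ?_)
  refine AbstractEquiv.trans (.of_entails ?_ ?_)
    ((AbstractEquiv.subst_cons p ts i t hC hts).trans (add t ht).symm)
  · intro N a ha
    obtain ⟨h₁, h₂⟩ := BConj.holds_cons.1 ha
    refine BConj.holds_cons.2 ⟨?_, h₂⟩
    rw [BConj.holds_eq] at h₁ ⊢
    exact h₁.trans (BConj.holds_eq.1 (BConj.holds_cons.1 (h N a h₂)).1)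
  · intro N a ha
    obtain ⟨h₁, h₂⟩ := BConj.holds_cons.1 ha
    refine BConj.holds_cons.2 ⟨?_, h₂⟩
    rw [BConj.holds_eq] at h₁ ⊢
    exact h₁.trans (BConj.holds_eq.1 (BConj.holds_cons.1 (h N a h₂)).1).symm

theorem AbstractEquiv.congr_args (C : Multiset (UserConstraint L U)) {n : ℕ} (p : U n)
    (s t : Fin n → L.Term Var) {E : BConj L} (X : Finset Var)
    (h : ∀ i, Entails CT E [.eq (s i) (t i)]) :
    AbstractEquiv CT ⟨⟨n, p, s⟩ ::ₘ C, E, X⟩ ⟨⟨n, p, t⟩ ::ₘ C, E, X⟩ := by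
  -- The arguments are exchanged one position at a time; `S` is the set of positions already
  -- treated.
  have key : ∀ S : Finset (Fin n), AbstractEquiv CT ⟨⟨n, p, s⟩ ::ₘ C, E, X⟩
      ⟨⟨n, p, fun i => if i ∈ S then t i else s i⟩ ::ₘ C, E, X⟩ := fun S => by
    induction S using Finset.induction_on with
    | empty => simpa using AbstractEquiv.refl _
    | insert i S hi ih =>
      refine ih.trans ?_
      convert AbstractEquiv.update_arg C p (fun i => if i ∈ S then t i else s i) i X (h i)
        using 4
      · funext j
        by_cases hj : j = i
        · subst hj; simp [hi]
        · simp [hj]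
      · funext j
        by_cases hj : j = i
        · subst hj; simp
        · simp [hj]
  simpa using key Finset.univ

/-- Two user-defined constraints are the same up to equalities that `E` entails. -/
def SameUnder (CT : L.Theory) (E : BConj L) (c d : UserConstraint L U) : Prop :=
  ∃ (n : ℕ) (p : U n) (s t : Fin n → L.Term Var), c = ⟨n, p, s⟩ ∧ d = ⟨n, p, t⟩ ∧
    ∀ i, Entails CT E [.eq (s i) (t i)]

theorem AbstractEquiv.congr_store {A B : Multiset (UserConstraint L U)} {E : BConj L}
    (h : Multiset.Rel (SameUnder CT E) A B) (C : Multiset (UserConstraint L U)) (X : Finset Var) :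
    AbstractEquiv CT ⟨A + C, E, X⟩ ⟨B + C, E, X⟩ := by
  induction h generalizing C with
  | zero => exact .refl _
  | @cons a b as bs hab _ ih =>
    obtain ⟨n, p, s, t, rfl, rfl, hst⟩ := hab
    have h₁ := AbstractEquiv.congr_args (as + C) p s t X hst
    -- The atom already replaced joins the untouched context, which is why the induction is general
    -- in `C`.
    have h₂ := ih (⟨n, p, t⟩ ::ₘ C)
    rw [Multiset.add_cons, Multiset.add_cons] at h₂
    rw [Multiset.cons_add, Multiset.cons_add]
    exact h₁.trans h₂

/-- Renamings that are equal under `E` on the variables of the store give equivalent stores. -/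
theorem SameUnder.rel_rename {E : BConj L} (A : Multiset (UserConstraint L U)) {θ θ' : Var → Var}
    (h : ∀ x ∈ userFv A, Entails CT E [.eq (Term.var (θ x)) (Term.var (θ' x))]) :
    Multiset.Rel (SameUnder CT E) (A.map (UserConstraint.rename θ))
      (A.map (UserConstraint.rename θ')) := by
  rw [Multiset.rel_map]
  refine Multiset.rel_refl_of_refl_on fun c hc => ⟨_, c.pred, _, _, rfl, rfl, fun i N a ha => ?_⟩
  refine BConj.holds_cons.2 ⟨?_, by simp [BConj.Holds]⟩
  rw [BConj.holds_eq, Term.realize_relabel, Term.realize_relabel]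
  refine term_realize_congr _ fun x hx => ?_
  exact BConj.holds_eq.1 (BConj.holds_cons.1
    (h x (mem_userFv.2 ⟨c, hc, UserConstraint.mem_fv.2 ⟨i, hx⟩⟩) N a ha)).1

end Equivalence

/-! ### Variants of rules -/

section Variants

variable {L : FirstOrder.Language.{u, v}} {U : ℕ → Type w}

theorem exists_fresh_perm (S : Finset Var) : ∃ π : Equiv.Perm Var, ∀ x ∈ S, π x ∉ S := by
  -- `S` lies below `m`; the permutation swaps the blocks `[0, m)` and `[m, 2m)`. A permutation is
  -- needed because variants of rules are defined by permutations.
  let m : ℕ := S.sup id + 1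
  let f : ℕ → ℕ := fun x => if x < m then x + m else if x < 2 * m then x - m else x
  have hf : Function.Involutive f := fun x => by
    simp only [f]
    split_ifs <;> omega
  have hm : ∀ x ∈ S, (x : ℕ) < m := fun x hx =>
    Nat.lt_succ_of_le (Finset.le_sup (f := id) hx)
  refine ⟨hf.toPerm, fun x hx h => ?_⟩
  have h₁ := hm x hx
  have h₂ : f x < m := hm _ h
  simp only [f, h₁, if_true] at h₂
  omega

theorem store_rename_rename (C : Multiset (UserConstraint L U)) (θ ψ : Var → Var) :
    (C.map (UserConstraint.rename θ)).map (UserConstraint.rename ψ) =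
      C.map (UserConstraint.rename (ψ ∘ θ)) := by
  simp [UserConstraint.rename, Function.comp_def]
  rfl

theorem builtIn_rename_rename (E : BConj L) (θ ψ : Var → Var) :
    (E.rename θ).rename ψ = E.rename (ψ ∘ θ) := by
  unfold BConj.rename
  rw [List.map_map]
  refine List.map_congr_left fun b _ => ?_
  cases b <;> simp [BuiltIn.rename]

namespace Rule

/-- All variables of a rule. -/
def fv (r : Rule L U) : Finset Var :=
  r.headFv ∪ (r.guard.fv ∪ r.bodyBuiltIn.fv ∪ userFv r.bodyUser)

theorem headFv_rename (r : Rule L U) (π : Equiv.Perm Var) :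
    (r.rename π).headFv = r.headFv.image π := by
  simp only [headFv, rename, userFv_rename, Finset.image_union]

theorem localVars_rename (r : Rule L U) (π : Equiv.Perm Var) :
    (r.rename π).localVars = r.localVars.image π := by
  rw [localVars, localVars, headFv_rename, Finset.image_sdiff _ _ π.injective]
  simp only [rename, userFv_rename, BConj.fv_rename, Finset.image_union]

theorem ext' {r s : Rule L U} (h₁ : r.kept = s.kept) (h₂ : r.removed = s.removed)
    (h₃ : r.guard = s.guard) (h₄ : r.bodyBuiltIn = s.bodyBuiltIn)
    (h₅ : r.bodyUser = s.bodyUser) : r = s := by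
  cases r; cases s; simp_all

theorem rename_rename (r : Rule L U) (ρ π : Equiv.Perm Var) :
    (r.rename ρ).rename π = r.rename (ρ.trans π) :=
  ext' (store_rename_rename _ _ _) (store_rename_rename _ _ _) (builtIn_rename_rename _ _ _)
    (builtIn_rename_rename _ _ _) (store_rename_rename _ _ _)

theorem rename_refl (r : Rule L U) : r.rename (Equiv.refl Var) = r :=
  ext' (store_rename_id _) (store_rename_id _) (BConj.rename_id _) (BConj.rename_id _)
    (store_rename_id _)

theorem disjoint_localVars_headFv (r : Rule L U) : Disjoint r.localVars r.headFv :=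
  Finset.sdiff_disjoint

theorem mem_fv_of_localVars {r : Rule L U} {x : Var} (h : x ∈ r.localVars) : x ∈ r.fv :=
  Finset.mem_union_right _ (Finset.mem_sdiff.1 h).1

theorem mem_fv_iff {r : Rule L U} {x : Var} :
    x ∈ r.fv ↔ x ∈ r.headFv ∨ x ∈ r.localVars := by
  simp only [fv, localVars, Finset.mem_union, Finset.mem_sdiff]
  tauto

end Rule

end Variants

/-! ### Simulation of derivations by more instantiated states -/

section Simulation

variable {L : FirstOrder.Language.{u, v}} {U : ℕ → Type w} {CT : L.Theory} {P : Program L U}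

theorem AbstractEquiv.steps {σ τ : State L U} (h : AbstractEquiv CT σ τ) :
    AbstractSteps CT P σ τ := .single (.inr h)

theorem AbstractStep.steps {σ τ : State L U} (h : AbstractStep CT P σ τ) :
    AbstractSteps CT P σ τ := .single (.inl h)

theorem AbstractSteps.trans {σ τ υ : State L U} (h : AbstractSteps CT P σ τ)
    (h' : AbstractSteps CT P τ υ) : AbstractSteps CT P σ υ := Relation.TransGen.trans h h'

variable {M : Type (max u v)}

/-- The state `σ'` under `v'` refines the state `σ` under `v` via the renaming `θ`. -/
structure Refines (CT : L.Theory) (θ : Var → Var) (v v' : Var → M) (σ' σ : State L U) : Prop where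
  store : σ'.store = σ.store.map (UserConstraint.rename θ)
  builtIn : Entails CT σ'.builtIn (σ.builtIn.rename θ)
  globals : ∀ x ∈ σ.globals, θ x ∈ σ'.globals ∧ v' (θ x) = v x

/-- A witness for the refined state, precomposed with `θ`, is a witness for the original one:
refinement only restricts the set of instances. -/
theorem Refines.sat [L.Structure M] [Nonempty M] [M ⊨ CT] {θ : Var → Var} {v v' : Var → M}
    {σ' σ : State L U}
    (h : Refines CT θ v v' σ' σ) {Q : Multiset (GroundAtom U M) → Prop} (hQ : σ'.Sat Q v') :
    σ.Sat Q v := by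
  obtain ⟨a, h₁, h₂, h₃⟩ := hQ
  refine ⟨a ∘ θ, fun x hx => ?_, BConj.holds_rename.1 (h.builtIn.holds h₂), ?_⟩
  · obtain ⟨h₄, h₅⟩ := h.globals x hx
    exact (h₁ _ h₄).trans h₅
  · rwa [h.store, groundStore_rename] at h₃

variable (M) in
/-- Derivations from `σ` to `τ` can be imitated by refinements of `σ`, and the values of finitely
many variables can be kept. -/
def Simulates (CT : L.Theory) (P : Program L U) (σ τ : State L U) : Prop :=
  ∀ (θ : Var → Var) (v v' : Var → M) (σ' : State L U), Refines CT θ v v' σ' σ →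
    ∀ W : Finset Var, ∃ (θ' : Var → Var) (v'' : Var → M) (τ' : State L U),
      AbstractSteps CT P σ' τ' ∧ Refines CT θ' v v'' τ' τ ∧ ∀ x ∈ W, v'' x = v' x

theorem Simulates.refl (σ : State L U) : Simulates M CT P σ σ :=
  fun θ _ v' σ' h _ => ⟨θ, v', σ', (AbstractEquiv.refl σ').steps, h, fun _ _ => rfl⟩

theorem Simulates.trans {σ τ υ : State L U} (h : Simulates M CT P σ τ)
    (h' : Simulates M CT P τ υ) : Simulates M CT P σ υ := fun θ v v' σ' hr W => by
  obtain ⟨θ₁, v₁, τ', hs₁, hr₁, hW₁⟩ := h θ v v' σ' hr W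
  obtain ⟨θ₂, v₂, υ', hs₂, hr₂, hW₂⟩ := h' θ₁ v v₁ τ' hr₁ W
  exact ⟨θ₂, v₂, υ', hs₁.trans hs₂, hr₂, fun x hx => (hW₂ x hx).trans (hW₁ x hx)⟩

theorem BConj.holds_singleton_eq {N : Type*} [L.Structure N] {a : Var → N} {s t : L.Term Var} :
    BConj.Holds a [BuiltIn.eq s t] ↔ s.realize a = t.realize a := by
  rw [BConj.holds_cons, BConj.holds_eq]
  simp [BConj.Holds]

theorem SameUnder.rel_subst {E : BConj L} (C : Multiset (UserConstraint L U)) {y : Var}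
    {t : L.Term Var} {θ : Var → Var}
    (h : Entails CT E (BConj.rename θ [.eq (Term.var y) t])) :
    Multiset.Rel (SameUnder CT E) (C.map (UserConstraint.rename θ))
      ((C.map (UserConstraint.subst (Function.update Term.var y t))).map
        (UserConstraint.rename θ)) := by
  rw [Multiset.map_map, Multiset.rel_map]
  refine Multiset.rel_refl_of_refl_on fun c _ => ⟨_, c.pred, _, _, rfl, rfl, fun i N a ha => ?_⟩
  have hy : a (θ y) = t.realize (a ∘ θ) :=
    BConj.holds_singleton_eq.1 (BConj.holds_rename.1 (h N a ha))
  rw [BConj.holds_singleton_eq, Term.realize_relabel]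
  change _ = (((c.args i).subst _).relabel θ).realize a
  rw [Term.realize_relabel, Term.realize_subst]
  congr 1
  funext x
  by_cases hx : x = y
  · subst hx; simpa using hy
  · simp [hx]

theorem AbstractEquiv.congr_store' {A B : Multiset (UserConstraint L U)} {E : BConj L}
    {X : Finset Var} (h : Multiset.Rel (SameUnder CT E) A B) :
    AbstractEquiv CT ⟨A, E, X⟩ ⟨B, E, X⟩ := by
  simpa using AbstractEquiv.congr_store h 0 X

/-! ### Simulation of the equivalence clauses and of rule application -/

theorem Simulates.subst (C : Multiset (UserConstraint L U)) (Y : Var) (t : L.Term Var)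
    (D : BConj L) (X : Finset Var) :
    Simulates M CT P ⟨C, .eq (Term.var Y) t :: D, X⟩
      ⟨C.map (UserConstraint.subst (Function.update Term.var Y t)),
        .eq (Term.var Y) t :: D, X⟩ := by
  rintro θ v v' ⟨C', E', X'⟩ ⟨h₁, h₂, h₃⟩ W
  refine ⟨θ, v', ⟨_, E', X'⟩, AbstractEquiv.steps ?_, ⟨rfl, h₂, h₃⟩, fun _ _ => rfl⟩
  simp only at h₁
  rw [h₁]
  refine .congr_store' (SameUnder.rel_subst C fun N a ha => ?_)
  have := BConj.holds_rename.1 (h₂ N a ha)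
  rw [BConj.holds_rename, BConj.holds_singleton_eq]
  exact BConj.holds_eq.1 (BConj.holds_cons.1 this).1

theorem Simulates.subst_symm (C : Multiset (UserConstraint L U)) (Y : Var) (t : L.Term Var)
    (D : BConj L) (X : Finset Var) :
    Simulates M CT P
      ⟨C.map (UserConstraint.subst (Function.update Term.var Y t)), .eq (Term.var Y) t :: D, X⟩
      ⟨C, .eq (Term.var Y) t :: D, X⟩ := by
  rintro θ v v' ⟨C', E', X'⟩ ⟨h₁, h₂, h₃⟩ W
  refine ⟨θ, v', ⟨_, E', X'⟩, AbstractEquiv.steps ?_, ⟨rfl, h₂, h₃⟩, fun _ _ => rfl⟩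
  simp only at h₁
  rw [h₁]
  refine (AbstractEquiv.congr_store' (SameUnder.rel_subst C fun N a ha => ?_)).symm
  have := BConj.holds_rename.1 (h₂ N a ha)
  rw [BConj.holds_rename, BConj.holds_singleton_eq]
  exact BConj.holds_eq.1 (BConj.holds_cons.1 this).1

/-- A refinement of an inconsistent state is itself inconsistent, so its store may be exchanged for
any other. -/
theorem Simulates.inconsistent (C D : Multiset (UserConstraint L U)) (X : Finset Var) :
    Simulates M CT P ⟨C, [.falsum], X⟩ ⟨D, [.falsum], X⟩ := by
  rintro θ v v' ⟨C', E', X'⟩ ⟨h₁, h₂, h₃⟩ W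
  refine ⟨θ, v', ⟨_, [.falsum], X'⟩, AbstractEquiv.steps ?_, ⟨rfl, fun N a ha => ha, h₃⟩,
    fun _ _ => rfl⟩
  refine AbstractEquiv.trans (.of_entails h₂ fun N a ha => ?_) (.rel _ _ (.inconsistent _ _ _))
  exact absurd ha BConj.not_holds_falsum

theorem Simulates.builtIn (C : Multiset (UserConstraint L U)) (D E : BConj L) (X : Finset Var)
    (h : ∀ (N : Theory.ModelType.{u, v, max u v} CT) (a : Var → N), D.Holds a →
      ∃ b : Var → N, (∀ x ∈ userFv C ∪ X, b x = a x) ∧ E.Holds b) :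
    Simulates M CT P ⟨C, D, X⟩ ⟨C, E, X⟩ := by
  rintro θ v v' ⟨C', D', X'⟩ ⟨h₁, h₂, h₃⟩ W
  simp only at h₁ h₂ h₃
  subst h₁
  let S := E.fv ∪ (userFv (C.map (UserConstraint.rename θ)) ∪ X' ∪ D'.fv)
  obtain ⟨π, hπ⟩ := exists_fresh_perm S
  -- The variables that are existential in the built-in clause are sent to fresh ones by `π`, so the
  -- renamed `E` can be added to `D'` without interference.
  let θ' : Var → Var := fun x => if x ∈ userFv C ∪ X then θ x else π x
  have hθ : ∀ x ∈ userFv C ∪ X, θ' x = θ x := fun x hx => by simp only [θ', hx, if_true]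
  refine ⟨θ', v', ⟨C.map (UserConstraint.rename θ), E.rename θ' ++ D', X'⟩,
    AbstractEquiv.steps (.add_builtIn (fun N a ha => (BConj.holds_append.1 ha).2) ?_),
    ⟨store_rename_congr fun x hx => (hθ x (Finset.mem_union_left _ hx)).symm,
      fun N a ha => (BConj.holds_append.1 ha).1, fun x hx => ?_⟩, fun _ _ => rfl⟩
  · intro N a ha
    obtain ⟨c, hc, hE⟩ := h N (a ∘ θ) (BConj.holds_rename.1 (h₂ N a ha))
    -- The solution `c` of `E` is transported to the fresh copies; all old variables keep their
    -- values.
    let b : Var → N := fun z => if z ∈ S then a z else c (π.symm z)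
    have hb : ∀ z ∈ S, b z = a z := fun z hz => by simp only [b, hz, if_true]
    refine ⟨b, fun x hx => hb x ?_, BConj.holds_append.2 ⟨BConj.holds_rename.2
      ((BConj.holds_congr fun x hx => ?_).2 hE), (BConj.holds_congr fun x hx => hb x ?_).2 ha⟩⟩
    · exact Finset.mem_union_right _ (Finset.mem_union_left _ hx)
    · by_cases hxC : x ∈ userFv C ∪ X
      · simp only [Function.comp, hθ x hxC]
        rw [hb, hc x hxC, Function.comp]
        refine Finset.mem_union_right _ (Finset.mem_union_left _ ?_)
        rcases Finset.mem_union.1 hxC with hx | hx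
        · rw [userFv_rename]
          exact Finset.mem_union_left _ (Finset.mem_image_of_mem _ hx)
        · exact Finset.mem_union_right _ (h₃ x hx).1
      · have := hπ x (Finset.mem_union_left _ hx)
        simp only [Function.comp, θ', hxC, if_false, b, this, Equiv.symm_apply_apply]
    · exact Finset.mem_union_right _ (Finset.mem_union_right _ hx)
  · rw [hθ x (Finset.mem_union_right _ hx)]
    exact h₃ x hx

/-- The new global `Y` needs a counterpart of value `v Y` in the refinement. A fresh `y` is made
global and given that value; this is where the valuation changes, outside `W`. -/
theorem Simulates.insert_global (C : Multiset (UserConstraint L U)) (E : BConj L) (X : Finset Var)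
    (Y : Var) (hY : Y ∉ userFv C ∪ E.fv) :
    Simulates M CT P ⟨C, E, X⟩ ⟨C, E, insert Y X⟩ := by
  rintro θ v v' ⟨C', E', X'⟩ ⟨h₁, h₂, h₃⟩ W
  simp only at h₁ h₂ h₃
  subst h₁
  obtain ⟨y, hy⟩ := Infinite.exists_notMem_finset
    ((userFv (C.map (UserConstraint.rename θ)) ∪ E'.fv) ∪ (X' ∪ W))
  rw [Finset.mem_union, not_or] at hy
  have hθ : ∀ x ∈ userFv C ∪ E.fv, Function.update θ Y y x = θ x := fun x hx => by
    rw [Function.update_of_ne]; rintro rfl; exact hY hx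
  have hv : ∀ x ∈ X' ∪ W, Function.update v' y (v Y) x = v' x := fun x hx => by
    rw [Function.update_of_ne]; rintro rfl; exact hy.2 hx
  refine ⟨Function.update θ Y y, Function.update v' y (v Y),
    ⟨C.map (UserConstraint.rename θ), E', insert y X'⟩,
    AbstractEquiv.steps (.rel _ _ (.globals _ _ _ _ hy.1)),
    ⟨store_rename_congr fun x hx => (hθ x (Finset.mem_union_left _ hx)).symm,
      fun N a ha => ?_, fun x hx => ?_⟩, fun x hx => hv x (Finset.mem_union_right _ hx)⟩
  · rw [BConj.holds_rename]
    refine (BConj.holds_congr fun x hx => ?_).1 (BConj.holds_rename.1 (h₂ N a ha))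
    simp only [Function.comp, hθ x (Finset.mem_union_right _ hx)]
  · by_cases hxY : x = Y
    · subst hxY; simp
    · obtain ⟨h₄, h₅⟩ := h₃ x (Finset.mem_of_mem_insert_of_ne hx hxY)
      rw [Function.update_of_ne hxY]
      exact ⟨Finset.mem_insert_of_mem h₄, (hv _ (Finset.mem_union_left _ h₄)).trans h₅⟩

theorem Simulates.erase_global (C : Multiset (UserConstraint L U)) (E : BConj L) (X : Finset Var)
    (Y : Var) : Simulates M CT P ⟨C, E, insert Y X⟩ ⟨C, E, X⟩ := by
  rintro θ v v' σ' ⟨h₁, h₂, h₃⟩ W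
  exact ⟨θ, v', σ', (AbstractEquiv.refl _).steps,
    ⟨h₁, h₂, fun x hx => h₃ x (Finset.mem_insert_of_mem hx)⟩, fun _ _ => rfl⟩

theorem Simulates.of_clause {σ τ : State L U} (h : EquivClause CT σ τ) :
    Simulates M CT P σ τ ∧ Simulates M CT P τ σ := by
  cases h with
  | subst C Y t D X => exact ⟨.subst C Y t D X, .subst_symm C Y t D X⟩
  | inconsistent C D X => exact ⟨.inconsistent C D X, .inconsistent D C X⟩
  | globals C E X Y hY => exact ⟨.insert_global C E X Y hY, .erase_global C E X Y⟩
  | builtIn C D E X h =>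
    have key : ∀ (N : Theory.ModelType.{u, v, max u v} CT) (a : Var → N),
        (∃ b : Var → N, (∀ x ∈ userFv C ∪ X, b x = a x) ∧ D.Holds b) ↔
        (∃ b : Var → N, (∀ x ∈ userFv C ∪ X, b x = a x) ∧ E.Holds b) := fun N a => by
      have := h.realize_formula N (v := a)
      rw [Formula.realize_iff, realize_exExcept, realize_exExcept] at this
      simpa only [BConj.realize_toFormula] using this
    exact ⟨.builtIn C D E X fun N a ha => (key N a).1 ⟨a, fun _ _ => rfl, ha⟩,
      .builtIn C E D X fun N a ha => (key N a).2 ⟨a, fun _ _ => rfl, ha⟩⟩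

theorem Simulates.of_equiv {σ τ : State L U} (h : AbstractEquiv CT σ τ) :
    Simulates M CT P σ τ ∧ Simulates M CT P τ σ := by
  induction h with
  | rel _ _ h => exact Simulates.of_clause h
  | refl _ => exact ⟨Simulates.refl _, Simulates.refl _⟩
  | symm _ _ _ ih => exact ih.symm
  | trans _ _ _ _ _ ih₁ ih₂ => exact ⟨ih₁.1.trans ih₂.1, ih₂.2.trans ih₁.2⟩

/-- As `θ` need not be injective, the `θ`-image of a rule need not be a variant. A fresh variant is
taken instead, and equations identify its head variables with their `θ`-images: the heads then match
up to equivalence, and the local variables are fresh. -/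
theorem Simulates.apply (r : Rule L U) (hr : r ∈ P) (ρ : Equiv.Perm Var)
    (D : Multiset (UserConstraint L U)) (E : BConj L) (X : Finset Var)
    (hX : Disjoint (r.rename ρ).localVars X)
    (hfresh : Disjoint (r.rename ρ).localVars (userFv D ∪ E.fv)) :
    Simulates M CT P
      ⟨(r.rename ρ).kept + (r.rename ρ).removed + D, (r.rename ρ).guard ++ E, X⟩
      ⟨(r.rename ρ).bodyUser + (r.rename ρ).kept + D,
        (r.rename ρ).bodyBuiltIn ++ ((r.rename ρ).guard ++ E), X⟩ := by
  rintro θ v v' ⟨C', E', X'⟩ ⟨h₁, h₂, h₃⟩ W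
  have hren : ∀ π : Equiv.Perm Var, (r.rename ρ).rename π = r.rename (ρ.trans π) :=
    r.rename_rename ρ
  generalize r.rename ρ = R at *
  simp only at h₁ h₂ h₃
  rw [Multiset.map_add] at h₁
  have hhead : userFv (R.kept + R.removed) = R.headFv := userFv_add _ _
  let S := R.fv ∪ (userFv C' ∪ E'.fv ∪ X')
  obtain ⟨π, hπ⟩ := exists_fresh_perm S
  have hπS : ∀ x ∈ R.fv, π x ∉ S := fun x hx => hπ x (Finset.mem_union_left _ hx)
  have hhfv : ∀ x ∈ R.headFv, x ∈ R.fv := fun x hx => Rule.mem_fv_iff.2 (.inl hx)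
  have hθC : ∀ x ∈ R.headFv, θ x ∈ userFv C' := fun x hx => by
    rw [h₁, userFv_add, userFv_rename, hhead]
    exact Finset.mem_union_left _ (Finset.mem_image_of_mem _ hx)
  have hCS : ∀ x ∈ userFv C', x ∈ S := fun x hx => Finset.mem_union_right _
    (Finset.mem_union_left _ (Finset.mem_union_left _ hx))
  have hES : ∀ x ∈ E'.fv, x ∈ S := fun x hx => Finset.mem_union_right _
    (Finset.mem_union_left _ (Finset.mem_union_right _ hx))
  have hXS : ∀ x ∈ X', x ∈ S := fun x hx => Finset.mem_union_right _
    (Finset.mem_union_right _ hx)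
  let eqs : BConj L := R.headFv.toList.map fun x => .eq (Term.var (π x)) (Term.var (θ x))
  have holds_eqs : ∀ {N : Type (max u v)} [L.Structure N] (a : Var → N),
      eqs.Holds a ↔ ∀ x ∈ R.headFv, a (π x) = a (θ x) := fun a => by
    simp only [BConj.Holds, eqs, List.forall_mem_map, BConj.holds_eq, Finset.mem_toList,
      Term.realize_var]
  let E₁ := R.guard.rename π ++ (eqs ++ E')
  have hE₁ : ∀ (N : Theory.ModelType.{u, v, max u v} CT) (a : Var → N), E₁.Holds a →
      (R.guard.rename π).Holds a ∧ (∀ x ∈ R.headFv, a (π x) = a (θ x)) ∧ E'.Holds a := by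
    intro N a ha
    obtain ⟨hG, ha⟩ := BConj.holds_append.1 ha
    obtain ⟨he, ha⟩ := BConj.holds_append.1 ha
    exact ⟨hG, (holds_eqs a).1 he, ha⟩
  have s₁ : AbstractEquiv CT ⟨C', E', X'⟩ ⟨C', E₁, X'⟩ := by
    refine .add_builtIn (fun N a ha => (hE₁ N a ha).2.2) fun N a ha => ?_
    -- Each fresh variable `π x` copies the value of `θ x`, so the new equations and the renamed
    -- guard hold.
    let b : Var → N := fun z => if z ∈ S then a z else a (θ (π.symm z))
    have hb : ∀ z ∈ S, b z = a z := fun z hz => by simp only [b, hz, if_true]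
    have hbπ : ∀ x ∈ R.fv, b (π x) = a (θ x) := fun x hx => by
      simp only [b, hπS x hx, if_false, Equiv.symm_apply_apply]
    refine ⟨b, fun x hx => hb x ?_, BConj.holds_append.2 ⟨?_, BConj.holds_append.2 ⟨?_, ?_⟩⟩⟩
    · rcases Finset.mem_union.1 hx with hx | hx
      exacts [hCS x hx, hXS x hx]
    · have hG := h₂ N a ha
      rw [BConj.rename_append, BConj.holds_append, BConj.holds_rename] at hG
      rw [BConj.holds_rename]
      refine (BConj.holds_congr fun x hx => ?_).1 hG.1
      exact (hbπ x (Finset.mem_union_right _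
        (Finset.mem_union_left _ (Finset.mem_union_left _ hx)))).symm
    · rw [holds_eqs]
      intro x hx
      rw [hbπ x (hhfv x hx), hb _ (hCS _ (hθC x hx))]
    · exact (BConj.holds_congr fun x hx => hb x (hES x hx)).2 ha
  have s₂ : AbstractEquiv CT ⟨C', E₁, X'⟩
      ⟨(R.rename π).kept + (R.rename π).removed + D.map (UserConstraint.rename θ),
        (R.rename π).guard ++ (eqs ++ E'), X'⟩ := by
    have : (R.rename π).kept + (R.rename π).removed =
        (R.kept + R.removed).map (UserConstraint.rename π) := (Multiset.map_add _ _ _).symm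
    rw [h₁, this]
    refine AbstractEquiv.congr_store (SameUnder.rel_rename _ fun x hx N a ha => ?_) _ _
    rw [BConj.holds_singleton_eq]
    exact ((hE₁ N a ha).2.1 x (hhead ▸ hx)).symm
  have s₃ : AbstractStep CT P
      ⟨(R.rename π).kept + (R.rename π).removed + D.map (UserConstraint.rename θ),
        (R.rename π).guard ++ (eqs ++ E'), X'⟩
      ⟨(R.rename π).bodyUser + (R.rename π).kept + D.map (UserConstraint.rename θ),
        (R.rename π).bodyBuiltIn ++ ((R.rename π).guard ++ (eqs ++ E')), X'⟩ := by
    have hloc : ∀ x ∈ (R.rename π).localVars, x ∉ S := fun x hx => by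
      rw [Rule.localVars_rename, Finset.mem_image] at hx
      obtain ⟨y, hy, rfl⟩ := hx
      exact hπS y (Rule.mem_fv_of_localVars hy)
    have hl₁ : Disjoint (R.rename π).localVars X' :=
      Finset.disjoint_left.2 fun x hx hx' => hloc x hx (hXS x hx')
    have hl₂ : Disjoint (R.rename π).localVars
        (userFv (D.map (UserConstraint.rename θ)) ∪ BConj.fv (eqs ++ E')) := by
      refine Finset.disjoint_left.2 fun x hx hx' => ?_
      rw [BConj.fv_append] at hx'
      rcases Finset.mem_union.1 hx' with hx' | hx'
      · refine hloc x hx (hCS x ?_)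
        rw [h₁, userFv_add]
        exact Finset.mem_union_right _ hx'
      rcases Finset.mem_union.1 hx' with hx' | hx'
      · obtain ⟨b, hb, hx'⟩ := BConj.mem_fv.1 hx'
        obtain ⟨y, hy, rfl⟩ := List.mem_map.1 hb
        rw [Finset.mem_toList] at hy
        rcases Finset.mem_union.1 hx' with hx' | hx'
        · rw [Term.varFinset, Finset.mem_singleton] at hx'
          refine Finset.disjoint_left.1 (R.rename π).disjoint_localVars_headFv hx ?_
          rw [Rule.headFv_rename, hx']
          exact Finset.mem_image_of_mem _ hy
        · rw [Term.varFinset, Finset.mem_singleton] at hx'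
          exact hloc x hx (hCS x (hx' ▸ hθC y hy))
      · exact hloc x hx (hES x hx')
    rw [hren] at hl₁ hl₂ ⊢
    exact Step.apply r hr _ _ _ _ hl₁ hl₂
  -- Local variables follow the fresh variant; all others keep their `θ`-image, equal to the
  -- `π`-image on the heads by the equations.
  let θ' : Var → Var := fun x => if x ∈ R.localVars then π x else θ x
  have hθ' : ∀ x ∉ R.localVars, θ' x = θ x := fun x hx => by simp only [θ', hx, if_false]
  have hDE : ∀ x ∈ userFv D ∪ E.fv, θ' x = θ x := fun x hx =>
    hθ' x fun h => Finset.disjoint_left.1 hfresh h hx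
  have hbody : ∀ (N : Theory.ModelType.{u, v, max u v} CT) (a : Var → N),
      (∀ x ∈ R.headFv, a (π x) = a (θ x)) → ∀ x ∈ R.fv, a (π x) = a (θ' x) := by
    intro N a ha x hx
    by_cases hl : x ∈ R.localVars
    · simp only [θ', hl, if_true]
    · rw [hθ' x hl]
      exact ha x ((Rule.mem_fv_iff.1 hx).resolve_right hl)
  have s₄ : AbstractEquiv CT
      ⟨(R.rename π).bodyUser + (R.rename π).kept + D.map (UserConstraint.rename θ),
        (R.rename π).bodyBuiltIn ++ ((R.rename π).guard ++ (eqs ++ E')), X'⟩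
      ⟨(R.bodyUser + R.kept + D).map (UserConstraint.rename θ'),
        (R.rename π).bodyBuiltIn ++ ((R.rename π).guard ++ (eqs ++ E')), X'⟩ := by
    have : (R.rename π).bodyUser + (R.rename π).kept =
        (R.bodyUser + R.kept).map (UserConstraint.rename π) := (Multiset.map_add _ _ _).symm
    rw [this, Multiset.map_add _ (R.bodyUser + R.kept),
      store_rename_congr (C := D) (θ := θ') fun x hx => hDE x (Finset.mem_union_left _ hx)]
    refine AbstractEquiv.congr_store (SameUnder.rel_rename _ fun x hx N a ha => ?_) _ _
    rw [BConj.holds_singleton_eq]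
    refine hbody N a (hE₁ N a (BConj.holds_append.1 ha).2).2.1 x ?_
    rw [userFv_add] at hx
    rcases Finset.mem_union.1 hx with hx | hx
    · exact Finset.mem_union_right _ (Finset.mem_union_right _ hx)
    · exact hhfv x (Finset.mem_union_left _ hx)
  refine ⟨θ', v', _, (s₁.trans s₂).steps.trans (s₃.steps.trans s₄.steps),
    ⟨rfl, fun N a ha => ?_, fun x hx => ?_⟩, fun _ _ => rfl⟩
  · obtain ⟨hC, ha⟩ := BConj.holds_append.1 ha
    obtain ⟨hG, he, ha⟩ := hE₁ N a ha
    have hE := h₂ N a ha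
    rw [BConj.rename_append, BConj.holds_append, BConj.holds_rename, BConj.holds_rename] at hE
    have hπθ := hbody N a he
    rw [BConj.holds_rename, BConj.holds_append, BConj.holds_append]
    refine ⟨(BConj.holds_congr fun x hx => ?_).1 (BConj.holds_rename.1 hC),
      (BConj.holds_congr fun x hx => ?_).1 (BConj.holds_rename.1 hG),
      (BConj.holds_congr fun x hx => ?_).2 hE.2⟩
    · exact hπθ x (Finset.mem_union_right _
        (Finset.mem_union_left _ (Finset.mem_union_right _ hx)))
    · exact hπθ x (Finset.mem_union_right _
        (Finset.mem_union_left _ (Finset.mem_union_left _ hx)))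
    · simp only [Function.comp, hDE x (Finset.mem_union_right _ hx)]
  · rw [hθ' x fun h => Finset.disjoint_left.1 hX h hx]
    exact h₃ x hx

theorem Simulates.of_step {σ τ : State L U} (h : AbstractStep CT P σ τ) :
    Simulates M CT P σ τ := by
  induction h with
  | apply r hr ρ D E X hX hfresh => exact .apply r hr ρ D E X hX hfresh
  | equiv h₁ _ h₂ ih => exact ((Simulates.of_equiv h₁).1.trans ih).trans (Simulates.of_equiv h₂).1

theorem Simulates.of_steps {σ τ : State L U} (h : AbstractSteps CT P σ τ) :
    Simulates M CT P σ τ := by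
  induction h with
  | single h => exact h.elim .of_step fun h => (Simulates.of_equiv h).1
  | tail _ h ih => exact ih.trans (h.elim .of_step fun h => (Simulates.of_equiv h).1)

end Simulation

/-! ### Ground derivations -/

section Ground

variable {L : FirstOrder.Language.{u, v}} {U : ℕ → Type w} {CT : L.Theory} {P : Program L U}

section

variable {M : Type*} [L.Structure M]

/-- Application of an instance of a rule to a multiset of ground atoms. -/
inductive GroundStep (P : Program L U) :
    Multiset (GroundAtom U M) → Multiset (GroundAtom U M) → Prop
  | apply (r : Rule L U) (hr : r ∈ P) (a : Var → M) (A : Multiset (GroundAtom U M))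
      (hG : r.guard.Holds a) (hC : r.bodyBuiltIn.Holds a) :
      GroundStep P (groundStore a (r.kept + r.removed) + A)
        (groundStore a (r.bodyUser + r.kept) + A)

/-- The ground atoms can be removed by ground steps. -/
def Vanishes (P : Program L U) (A : Multiset (GroundAtom U M)) : Prop :=
  Relation.ReflTransGen (GroundStep P) A 0

theorem GroundStep.add {A B : Multiset (GroundAtom U M)} (h : GroundStep P A B)
    (C : Multiset (GroundAtom U M)) : GroundStep P (A + C) (B + C) := by
  cases h with
  | apply r hr a A hG hC =>
    rw [add_assoc, add_assoc]
    exact .apply r hr a (A + C) hG hC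

theorem Vanishes.add {A B : Multiset (GroundAtom U M)} (hA : Vanishes P A) (hB : Vanishes P B) :
    Vanishes P (A + B) := by
  have : Relation.ReflTransGen (GroundStep P) (A + B) (0 + B) :=
    Relation.ReflTransGen.lift (p := GroundStep P) (· + B)
      (fun _ _ (h : GroundStep P _ _) => h.add B) _ _ hA
  rw [zero_add] at this
  exact this.trans hB

theorem GroundStep.apply_variant (r : Rule L U) (hr : r ∈ P) (ρ : Equiv.Perm Var) (a : Var → M)
    (A : Multiset (GroundAtom U M)) (hG : (r.rename ρ).guard.Holds a)
    (hC : (r.rename ρ).bodyBuiltIn.Holds a) :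
    GroundStep P (groundStore a ((r.rename ρ).kept + (r.rename ρ).removed) + A)
      (groundStore a ((r.rename ρ).bodyUser + (r.rename ρ).kept) + A) := by
  have := GroundStep.apply r hr (a ∘ ρ) A (BConj.holds_rename.1 hG) (BConj.holds_rename.1 hC)
  simpa only [Rule.rename, groundStore_add, groundStore_rename] using this

theorem groundStore_eq_zero {a : Var → M} {C : Multiset (UserConstraint L U)} :
    groundStore a C = 0 ↔ C = 0 := Multiset.map_eq_zero

theorem State.Sat.mono {Q R : Multiset (GroundAtom U M) → Prop} (hQR : ∀ A, Q A → R A)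
    {σ : State L U} {a : Var → M} (h : σ.Sat Q a) : σ.Sat R a :=
  h.imp fun _ h => ⟨h.1, h.2.1, hQR _ h.2.2⟩

/-- The ground atoms that occur in a vanishing multiset. -/
def Removable (P : Program L U) (x : GroundAtom U M) : Prop := ∃ A, x ∈ A ∧ Vanishes P A

/-- Vanishing multisets are closed under sums, so the multisets that witness each single atom can be
added up. This lets truth of a conjunction be truth of its atoms, regardless of multiplicities. -/
theorem exists_vanishes_add {B : Multiset (GroundAtom U M)} (h : ∀ x ∈ B, Removable P x) :
    ∃ A, Vanishes P (B + A) := by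
  induction B using Multiset.induction_on with
  | empty => exact ⟨0, Relation.ReflTransGen.refl⟩
  | cons x B ih =>
    obtain ⟨A, hA⟩ := ih fun y hy => h y (Multiset.mem_cons_of_mem hy)
    obtain ⟨C, hx, hC⟩ := h x (Multiset.mem_cons_self x B)
    obtain ⟨C, rfl⟩ := Multiset.exists_cons_of_mem hx
    refine ⟨C + A, ?_⟩
    have := hC.add hA
    have h' : x ::ₘ C + (B + A) = x ::ₘ B + (C + A) := by
      rw [Multiset.cons_add, Multiset.cons_add, add_left_comm]
    rwa [h'] at this

variable [Nonempty M] [M ⊨ CT]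

/-- Built-ins only accumulate along a rule application, so a valuation that witnesses the target
also satisfies the source, and one ground step leads from the source instance to the target
instance. -/
theorem AbstractStep.sat_vanishes {σ τ : State L U} (h : AbstractStep CT P σ τ) {a : Var → M}
    (hτ : τ.Sat (Vanishes P) a) : σ.Sat (Vanishes P) a := by
  induction h with
  | apply r hr ρ D E X hX hfresh =>
    obtain ⟨b, h₁, h₂, h₃⟩ := hτ
    obtain ⟨hC, h₂⟩ := BConj.holds_append.1 h₂
    have hG := (BConj.holds_append.1 h₂).1
    refine ⟨b, h₁, h₂, ?_⟩
    simp only at h₃ ⊢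
    rw [groundStore_add] at h₃ ⊢
    exact h₃.head (GroundStep.apply_variant r hr ρ b _ hG hC)
  | equiv h₁ _ h₂ ih => exact (h₁.sat_iff a).2 (ih ((h₂.sat_iff a).2 hτ))

theorem AbstractSteps.sat_vanishes {σ τ : State L U} (h : AbstractSteps CT P σ τ) {a : Var → M}
    (hτ : τ.Sat (Vanishes P) a) : σ.Sat (Vanishes P) a := by
  induction h with
  | single h => exact h.elim (·.sat_vanishes hτ) fun h => (h.sat_iff a).2 hτ
  | tail _ h ih => exact ih (h.elim (·.sat_vanishes hτ) fun h => (h.sat_iff a).2 hτ)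

/-- The heads of a rule are not both empty, so the store to which it applies has no empty instance;
invariance of `State.Sat` extends this to equivalent states. -/
theorem AbstractStep.not_sat_empty {σ τ : State L U} (h : AbstractStep CT P σ τ) (a : Var → M) :
    ¬ σ.Sat (· = 0) a := by
  induction h with
  | apply r hr ρ D E X hX hfresh =>
    rintro ⟨b, -, -, h⟩
    rw [groundStore_eq_zero] at h
    exact (r.rename ρ).head_ne (add_eq_zero.1 h).1
  | equiv h₁ _ _ ih => exact fun h => ih ((h₁.sat_iff a).1 h)

theorem AbstractSteps.sat_empty {σ τ : State L U} (h : AbstractSteps CT P σ τ) {a : Var → M}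
    (hσ : σ.Sat (· = 0) a) : τ.Sat (· = 0) a := by
  induction h with
  | single h => exact h.elim (fun h => absurd hσ (h.not_sat_empty a)) fun h => (h.sat_iff a).1 hσ
  | tail _ h ih => exact h.elim (fun h => absurd ih (h.not_sat_empty a)) fun h => (h.sat_iff a).1 ih

end

/-! ### Confluence and ground derivations -/

theorem SameUnder.mono {E F : BConj L} (h : Entails CT F E) {c d : UserConstraint L U}
    (hcd : SameUnder CT E c d) : SameUnder CT F c d := by
  obtain ⟨n, p, s, t, rfl, rfl, hst⟩ := hcd
  exact ⟨n, p, s, t, rfl, rfl, fun i N a ha => hst i N a (h N a ha)⟩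

/-- Stores with the same instance are the same under equations that hold for it. -/
theorem exists_equations {M : Type*} [L.Structure M] (a : Var → M)
    (A B : Multiset (UserConstraint L U)) (h : groundStore a A = groundStore a B) :
    ∃ F : BConj L, F.Holds a ∧ F.fv ⊆ userFv A ∪ userFv B ∧
      Multiset.Rel (SameUnder CT F) A B := by
  induction A using Multiset.induction_on generalizing B with
  | empty =>
    obtain rfl : B = 0 := Multiset.map_eq_zero.1 h.symm
    exact ⟨[], by simp [BConj.Holds], by simp [BConj.fv], .zero⟩
  | cons c A ih =>
    have hc : c.ground a ∈ groundStore a B := by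
      rw [← h]; exact Multiset.mem_map_of_mem _ (Multiset.mem_cons_self c A)
    obtain ⟨d, hd, hdc⟩ := Multiset.mem_map.1 hc
    obtain ⟨B, rfl⟩ := Multiset.exists_cons_of_mem hd
    have hAB : groundStore a A = groundStore a B := by
      simp only [groundStore, Multiset.map_cons, hdc] at h
      exact (Multiset.cons_inj_right _).1 h
    obtain ⟨F, hF, hfv, hrel⟩ := ih B hAB
    obtain ⟨n, p, s⟩ := c
    obtain ⟨n', p', t⟩ := d
    obtain rfl : n' = n := congrArg Sigma.fst hdc
    have hdc' := eq_of_heq (Sigma.mk.inj hdc).2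
    simp only [Prod.mk.injEq] at hdc'
    obtain ⟨rfl, hst⟩ := hdc'
    refine ⟨(List.ofFn fun i => .eq (s i) (t i)) ++ F, BConj.holds_append.2 ⟨?_, hF⟩, ?_,
      .cons ⟨_, p', s, t, rfl, rfl, fun i N b hb => ?_⟩ (hrel.mono fun x _ y _ hxy =>
        hxy.mono fun N b hb => (BConj.holds_append.1 hb).2)⟩
    · intro b hb
      obtain ⟨i, rfl⟩ := (List.mem_ofFn' _ _).1 hb
      exact BConj.holds_eq.2 (congrFun hst i).symm
    · intro x hx
      rw [BConj.fv_append] at hx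
      rcases Finset.mem_union.1 hx with hx | hx
      · obtain ⟨b, hb, hx⟩ := BConj.mem_fv.1 hx
        obtain ⟨i, rfl⟩ := (List.mem_ofFn' _ _).1 hb
        rcases Finset.mem_union.1 hx with hx | hx
        · exact Finset.mem_union_left _ (mem_userFv.2
            ⟨_, Multiset.mem_cons_self _ _, UserConstraint.mem_fv.2 ⟨i, hx⟩⟩)
        · exact Finset.mem_union_right _ (mem_userFv.2
            ⟨_, Multiset.mem_cons_self _ _, UserConstraint.mem_fv.2 ⟨i, hx⟩⟩)
      · rcases Finset.mem_union.1 (hfv hx) with hx | hx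
        · obtain ⟨e, he, hx⟩ := mem_userFv.1 hx
          exact Finset.mem_union_left _ (mem_userFv.2 ⟨e, Multiset.mem_cons_of_mem he, hx⟩)
        · obtain ⟨e, he, hx⟩ := mem_userFv.1 hx
          exact Finset.mem_union_right _ (mem_userFv.2 ⟨e, Multiset.mem_cons_of_mem he, hx⟩)
    · rw [BConj.holds_singleton_eq]
      exact BConj.holds_eq.1 ((BConj.holds_append.1 hb).1 _ ((List.mem_ofFn' _ _).2 ⟨i, rfl⟩))

theorem exists_add_of_groundStore_eq_add {M : Type*} [L.Structure M] {a : Var → M}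
    {D : Multiset (UserConstraint L U)} {A B : Multiset (GroundAtom U M)}
    (h : groundStore a D = A + B) :
    ∃ D₁ D₂, D = D₁ + D₂ ∧ groundStore a D₁ = A ∧ groundStore a D₂ = B := by
  induction A using Multiset.induction_on generalizing D with
  | empty => exact ⟨0, D, by simp, rfl, by simpa using h⟩
  | cons x A ih =>
    have hx : x ∈ groundStore a D := by rw [h]; simp
    obtain ⟨d, hd, rfl⟩ := Multiset.mem_map.1 hx
    obtain ⟨D, rfl⟩ := Multiset.exists_cons_of_mem hd
    have hD : groundStore a D = A + B := by
      simp only [groundStore, Multiset.map_cons, Multiset.cons_add] at h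
      exact (Multiset.cons_inj_right _).1 h
    obtain ⟨D₁, D₂, rfl, h₁, h₂⟩ := ih hD
    refine ⟨d ::ₘ D₁, D₂, by rw [Multiset.cons_add], ?_, h₂⟩
    rw [← h₁, groundStore, Multiset.map_cons, groundStore]

variable {M : Type (max u v)} [L.Structure M]

/-- A ground step on an instance of a state lifts to an abstract step from a refinement. -/
theorem GroundStep.lift {A B : Multiset (GroundAtom U M)} (h : GroundStep P A B)
    {σ : State L U} {a : Var → M} (hE : σ.builtIn.Holds a) (hA : groundStore a σ.store = A) :
    ∃ (a' : Var → M) (σ' τ' : State L U), Refines CT id a a' σ' σ ∧ AbstractStep CT P σ' τ' ∧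
      τ'.builtIn.Holds a' ∧ groundStore a' τ'.store = B := by
  obtain ⟨r, hr, c, A, hG, hC⟩ := h
  obtain ⟨D, E, X⟩ := σ
  obtain ⟨D₁, D₂, rfl, h₁, h₂⟩ := exists_add_of_groundStore_eq_add hA
  simp only at hE
  let S := r.fv ∪ (userFv (D₁ + D₂) ∪ E.fv ∪ X)
  obtain ⟨π, hπ⟩ := exists_fresh_perm S
  let R := r.rename π
  have hDS : ∀ x ∈ userFv (D₁ + D₂), x ∈ S := fun x hx => Finset.mem_union_right _
    (Finset.mem_union_left _ (Finset.mem_union_left _ hx))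
  have hES : ∀ x ∈ E.fv, x ∈ S := fun x hx => Finset.mem_union_right _
    (Finset.mem_union_left _ (Finset.mem_union_right _ hx))
  have hXS : ∀ x ∈ X, x ∈ S := fun x hx => Finset.mem_union_right _ (Finset.mem_union_right _ hx)
  -- One valuation for both: `a` on the variables of the state, the rule instance `c` on the fresh
  -- variant.
  let b : Var → M := fun z => if z ∈ S then a z else c (π.symm z)
  have hb : ∀ z ∈ S, b z = a z := fun z hz => by simp only [b, hz, if_true]
  have hbπ : ∀ x ∈ r.fv, b (π x) = c x := fun x hx => by
    have := hπ x (Finset.mem_union_left _ hx)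
    simp only [b, this, if_false, Equiv.symm_apply_apply]
  have hD₁ : ∀ x ∈ userFv D₁, b x = a x := fun x hx => hb x (hDS x (by
    rw [userFv_add]; exact Finset.mem_union_left _ hx))
  have hD₂ : ∀ x ∈ userFv D₂, b x = a x := fun x hx => hb x (hDS x (by
    rw [userFv_add]; exact Finset.mem_union_right _ hx))
  have hRG : R.guard.Holds b := BConj.holds_rename.2 ((BConj.holds_congr fun x hx =>
    hbπ x (Finset.mem_union_right _ (Finset.mem_union_left _ (Finset.mem_union_left _ hx)))).2 hG)
  have hRC : R.bodyBuiltIn.Holds b := BConj.holds_rename.2 ((BConj.holds_congr fun x hx =>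
    hbπ x (Finset.mem_union_right _ (Finset.mem_union_left _ (Finset.mem_union_right _ hx)))).2 hC)
  have hhfv : ∀ x ∈ r.headFv, x ∈ r.fv := fun x hx => Rule.mem_fv_iff.2 (.inl hx)
  have hhead : groundStore b (R.kept + R.removed) = groundStore c (r.kept + r.removed) := by
    change groundStore b (r.kept.map _ + r.removed.map _) = _
    rw [← Multiset.map_add, groundStore_rename]
    refine groundStore_congr fun x hx => hbπ x (hhfv x ?_)
    rwa [userFv_add] at hx
  have hbody : groundStore b (R.bodyUser + R.kept) = groundStore c (r.bodyUser + r.kept) := by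
    change groundStore b (r.bodyUser.map _ + r.kept.map _) = _
    rw [← Multiset.map_add, groundStore_rename]
    refine groundStore_congr fun x hx => hbπ x ?_
    rw [userFv_add] at hx
    rcases Finset.mem_union.1 hx with hx | hx
    · exact Finset.mem_union_right _ (Finset.mem_union_right _ hx)
    · exact hhfv x (Finset.mem_union_left _ hx)
  -- `D₁` and the heads agree only as instances. Adding `F` makes them match up to equivalence, and
  -- its variables are not local to the rule, so freshness is kept.
  obtain ⟨F, hF, hFfv, hrel⟩ := exists_equations (CT := CT) b D₁ (R.kept + R.removed)
    (by rw [groundStore_congr hD₁, h₁, hhead])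
  have hloc : ∀ x ∈ R.localVars, x ∉ S := fun x hx => by
    rw [Rule.localVars_rename, Finset.mem_image] at hx
    obtain ⟨y, hy, rfl⟩ := hx
    exact hπ y (Finset.mem_union_left _ (Rule.mem_fv_of_localVars hy))
  have hstep : AbstractStep CT P ⟨R.kept + R.removed + D₂, R.guard ++ (F ++ E), X⟩
      ⟨R.bodyUser + R.kept + D₂, R.bodyBuiltIn ++ (R.guard ++ (F ++ E)), X⟩ := by
    refine Step.apply r hr π _ _ _
      (Finset.disjoint_left.2 fun x hx hx' => hloc x hx (hXS x hx'))
      (Finset.disjoint_left.2 fun x hx hx' => ?_)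
    rw [BConj.fv_append] at hx'
    rcases Finset.mem_union.1 hx' with hx' | hx'
    · exact hloc x hx (hDS x (by rw [userFv_add]; exact Finset.mem_union_right _ hx'))
    rcases Finset.mem_union.1 hx' with hx' | hx'
    · rcases Finset.mem_union.1 (hFfv hx') with hx' | hx'
      · exact hloc x hx (hDS x (by rw [userFv_add]; exact Finset.mem_union_left _ hx'))
      · rw [userFv_add] at hx'
        exact Finset.disjoint_left.1 R.disjoint_localVars_headFv hx hx'
    · exact hloc x hx (hES x hx')
  refine ⟨b, ⟨D₁ + D₂, R.guard ++ (F ++ E), X⟩, _, ⟨(store_rename_id _).symm, ?_, ?_⟩,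
    .equiv (.congr_store (hrel.mono fun x _ y _ hxy => hxy.mono fun N d hd =>
      (BConj.holds_append.1 (BConj.holds_append.1 hd).2).1) _ _) hstep (.refl _), ?_, ?_⟩
  · intro N d hd
    rw [BConj.rename_id]
    exact (BConj.holds_append.1 (BConj.holds_append.1 hd).2).2
  · exact fun x hx => ⟨hx, hb x (hXS x hx)⟩
  · exact BConj.holds_append.2 ⟨hRC, BConj.holds_append.2 ⟨hRG, BConj.holds_append.2
      ⟨hF, (BConj.holds_congr fun x hx => hb x (hES x hx)).2 hE⟩⟩⟩
  · change groundStore b (R.bodyUser + R.kept + D₂) = _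
    rw [groundStore_add, hbody, groundStore_congr hD₂, h₂]

variable [Nonempty M] [M ⊨ CT]

/-- Induction on the ground derivation. If the instance is empty, only equivalences can occur.
Otherwise its first step lifts to a refinement of `σ`, the derivation to `τ` is simulated from
there, and confluence joins both results; vanishing passes forward to the join by induction, then
back to the refinement of `τ` and to `τ`. -/
theorem IsConfluent.sat_vanishes (hP : IsConfluent CT P) {A : Multiset (GroundAtom U M)}
    (hA : Vanishes P A) {σ τ : State L U} {a : Var → M} (hE : σ.builtIn.Holds a)
    (hσ : groundStore a σ.store = A) (h : AbstractSteps CT P σ τ) : τ.Sat (Vanishes P) a := by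
  unfold Vanishes at hA
  induction hA using Relation.ReflTransGen.head_induction_on generalizing σ τ a with
  | refl =>
    exact (h.sat_empty ⟨a, fun _ _ => rfl, hE, hσ⟩).mono fun A hA => by
      rw [hA]; exact Relation.ReflTransGen.refl
  | head hAB _ ih =>
    obtain ⟨a₁, σ', ξ, href, hstep, hξE, hξ⟩ := hAB.lift (CT := CT) hE hσ
    obtain ⟨θ, a₂, τ', hsim, href', hW⟩ :=
      -- Keeping the values on the variables of `ξ` ensures that its instance still vanishes under
      -- the new valuation.
      Simulates.of_steps h id a a₁ σ' href (ξ.builtIn.fv ∪ userFv ξ.store)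
    obtain ⟨ζ, h₁, h₂⟩ := hP σ' ξ τ' hstep.steps hsim
    refine href'.sat (h₂.sat_vanishes (ih ?_ ?_ h₁))
    · exact (BConj.holds_congr fun x hx => hW x (Finset.mem_union_left _ hx)).2 hξE
    · rw [groundStore_congr fun x hx => hW x (Finset.mem_union_right _ hx), hξ]

/-- The removable atoms satisfy the logical readings of the rules. -/
theorem IsConfluent.removable_iff (hP : IsConfluent CT P) {r : Rule L U} (hr : r ∈ P)
    {a : Var → M} (hK : ∀ x ∈ groundStore a r.kept, Removable P x) (hG : r.guard.Holds a) :
    (∀ x ∈ groundStore a r.removed, Removable P x) ↔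
      ∃ b : Var → M, (∀ x ∈ r.headFv, b x = a x) ∧ r.guard.Holds b ∧ r.bodyBuiltIn.Holds b ∧
        ∀ x ∈ groundStore b r.bodyUser, Removable P x := by
  constructor
  · intro hH
    -- The heads alone need not vanish; `A` supplies companions with which they do, and these become
    -- a store `D` with variables disjoint from the rule.
    obtain ⟨A, hA⟩ := exists_vanishes_add (B := groundStore a (r.kept + r.removed))
      fun x hx => by
        rw [groundStore_add] at hx
        exact (Multiset.mem_add.1 hx).elim (hK x) (hH x)
    obtain ⟨D, c, hc, hD, rfl⟩ := exists_store_eq_ground (L := L) A r.fv a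
    have hhfv : ∀ x ∈ r.headFv, x ∈ r.fv := fun x hx => Rule.mem_fv_iff.2 (.inl hx)
    have hhead : groundStore c (r.kept + r.removed) = groundStore a (r.kept + r.removed) :=
      groundStore_congr fun x hx => hc x (hhfv x (by rwa [userFv_add] at hx))
    have hl₁ : Disjoint r.localVars (r.headFv ∪ userFv D) := by
      refine Finset.disjoint_union_right.2 ⟨r.disjoint_localVars_headFv, ?_⟩
      exact Finset.disjoint_left.2 fun x hx hx' =>
        Finset.disjoint_left.1 hD hx' (Rule.mem_fv_of_localVars hx)
    have hl₂ : Disjoint r.localVars (userFv D ∪ BConj.fv ([] : BConj L)) := by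
      refine Finset.disjoint_left.2 fun x hx hx' => ?_
      refine Finset.disjoint_left.1 hl₁ hx (Finset.mem_union_right _ ?_)
      simpa [BConj.fv] using hx'
    have hstep : AbstractStep CT P
        ⟨r.kept + r.removed + D, r.guard ++ [], r.headFv ∪ userFv D⟩
        ⟨r.bodyUser + r.kept + D, r.bodyBuiltIn ++ (r.guard ++ []), r.headFv ∪ userFv D⟩ := by
      have := Step.apply (P := P) (eqv := AbstractEquiv CT) r hr (Equiv.refl Var) D []
        (r.headFv ∪ userFv D)
      rw [Rule.rename_refl] at this
      exact this hl₁ hl₂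
    -- The head variables are global in the chosen state, so `b` can differ from `c` on the local
    -- variables, which is just the existential quantifier of the reading.
    obtain ⟨b, hb, hE, hV⟩ := hP.sat_vanishes hA (a := c)
      (σ := ⟨r.kept + r.removed + D, r.guard ++ [], r.headFv ∪ userFv D⟩)
      (by
        simp only [List.append_nil]
        exact (BConj.holds_congr fun x hx => hc x (Finset.mem_union_right _
          (Finset.mem_union_left _ (Finset.mem_union_left _ hx)))).2 hG)
      (by simp only; rw [groundStore_add, hhead]) hstep.steps
    obtain ⟨hbC, hE⟩ := BConj.holds_append.1 hE
    refine ⟨b, fun x hx => (hb x (Finset.mem_union_left _ hx)).trans (hc x (hhfv x hx)),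
      (BConj.holds_append.1 hE).1, hbC, fun x hx => ⟨_, ?_, hV⟩⟩
    simp only
    rw [groundStore_add, groundStore_add]
    exact Multiset.mem_add.2 (.inl (Multiset.mem_add.2 (.inl hx)))
  · rintro ⟨b, hb, hG', hC, hB⟩ x hx
    have hK' : groundStore b r.kept = groundStore a r.kept :=
      groundStore_congr fun x hx => hb x (Finset.mem_union_left _ hx)
    have hH' : groundStore b r.removed = groundStore a r.removed :=
      groundStore_congr fun x hx => hb x (Finset.mem_union_right _ hx)
    obtain ⟨A, hA⟩ := exists_vanishes_add (B := groundStore b (r.bodyUser + r.kept))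
      fun x hx => by
        rw [groundStore_add, hK'] at hx
        exact (Multiset.mem_add.1 hx).elim (hB x) (hK x)
    refine ⟨_, ?_, Relation.ReflTransGen.head (GroundStep.apply r hr b A hG' hC) hA⟩
    rw [groundStore_add, hH']
    exact Multiset.mem_add.2 (.inl (Multiset.mem_add.2 (.inr hx)))

end Ground

/-! ### The logical reading -/

section Reading

variable {L : FirstOrder.Language.{u, v}} {U : ℕ → Type w} {CT : L.Theory} {P : Program L U}
  {N : Type*} [L.Structure N] [(fullLanguage L U).Structure N]

/-- The ground atom is true in the structure. -/
def AtomHolds (L : FirstOrder.Language.{u, v}) {U : ℕ → Type w} {N : Type*}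
    [(fullLanguage L U).Structure N] (x : GroundAtom U N) : Prop :=
  Structure.RelMap (L := fullLanguage L U) (Sum.inr x.2.1) x.2.2

variable [(LHom.sumInl : L →ᴸ fullLanguage L U).IsExpansionOn N]

theorem UserConstraint.realize_toFormula (c : UserConstraint L U) (a : Var → N) :
    c.toFormula.Realize a ↔ AtomHolds L (c.ground a) := by
  unfold UserConstraint.toFormula
  refine Formula.realize_rel.trans ?_
  simp only [LHom.realize_onTerm]
  rfl

theorem realize_userConj (C : Multiset (UserConstraint L U)) (a : Var → N) :
    (userConj C).Realize a ↔ ∀ x ∈ groundStore a C, AtomHolds L x := by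
  unfold userConj Formula.Realize
  rw [BoundedFormula.realize_foldr_inf]
  simp only [List.forall_mem_map, Multiset.mem_toList, groundStore, Multiset.forall_mem_map_iff]
  exact forall₂_congr fun c _ => c.realize_toFormula a

theorem realize_builtInConj (E : BConj L) (a : Var → N) :
    (builtInConj U E).Realize a ↔ E.Holds a := by
  unfold builtInConj
  rw [LHom.realize_onFormula, BConj.realize_toFormula]

theorem realize_reading [Nonempty N] (r : Rule L U) :
    r.reading.Realize N ↔ ∀ a : Var → N, (∀ x ∈ groundStore a r.kept, AtomHolds L x) →
      r.guard.Holds a → ((∀ x ∈ groundStore a r.removed, AtomHolds L x) ↔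
        ∃ b : Var → N, (∀ x ∈ r.headFv, b x = a x) ∧ r.guard.Holds b ∧ r.bodyBuiltIn.Holds b ∧
          ∀ x ∈ groundStore b r.bodyUser, AtomHolds L x) := by
  unfold Rule.reading
  rw [realize_allClosure]
  simp only [Formula.realize_imp, Formula.realize_iff, Formula.realize_inf, realize_exExcept,
    realize_userConj, realize_builtInConj, and_imp]

/-- Precomposing valuations with `ρ` turns a variant into the original rule; invertibility of `ρ`
carries the existential witness back. -/
theorem realize_reading_rename [Nonempty N] {r : Rule L U} (ρ : Equiv.Perm Var)
    (h : r.reading.Realize N) {a : Var → N}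
    (hK : ∀ x ∈ groundStore a (r.rename ρ).kept, AtomHolds L x)
    (hG : (r.rename ρ).guard.Holds a)
    (hH : ∀ x ∈ groundStore a (r.rename ρ).removed, AtomHolds L x) :
    ∃ b : Var → N, (∀ x ∈ (r.rename ρ).headFv, b x = a x) ∧ (r.rename ρ).guard.Holds b ∧
      (r.rename ρ).bodyBuiltIn.Holds b ∧
      ∀ x ∈ groundStore b (r.rename ρ).bodyUser, AtomHolds L x := by
  simp only [Rule.rename, groundStore_rename, BConj.holds_rename] at hK hG hH
  obtain ⟨b, hb, hG', hC, hB⟩ := ((realize_reading r).1 h (a ∘ ρ) hK hG).1 hH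
  have hbρ : (b ∘ ρ.symm) ∘ ρ = b := by funext x; simp
  refine ⟨b ∘ ρ.symm, fun x hx => ?_, ?_, ?_, ?_⟩
  · rw [Rule.headFv_rename, Finset.mem_image] at hx
    obtain ⟨y, hy, rfl⟩ := hx
    simpa using hb y hy
  · simpa only [Rule.rename, BConj.holds_rename, hbρ] using hG'
  · simpa only [Rule.rename, BConj.holds_rename, hbρ] using hC
  · simpa only [Rule.rename, groundStore_rename, hbρ] using hB

/-- Abstract steps preserve satisfaction in models of the logical reading. -/
theorem AbstractStep.sat_atoms [Nonempty N] [N ⊨ CT] (hN : ∀ r ∈ P, r.reading.Realize N)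
    {σ τ : State L U} (h : AbstractStep CT P σ τ) {a : Var → N}
    (hσ : σ.Sat (fun A => ∀ x ∈ A, AtomHolds L x) a) :
    τ.Sat (fun A => ∀ x ∈ A, AtomHolds L x) a := by
  induction h with
  | apply r hr ρ D E X hX hfresh =>
    obtain ⟨c, hc, hE, hD⟩ := hσ
    obtain ⟨hG, hE'⟩ := BConj.holds_append.1 hE
    simp only [groundStore_add, Multiset.mem_add, or_imp, forall_and] at hD
    obtain ⟨⟨hK, hH⟩, hD⟩ := hD
    obtain ⟨b, hb, hG', hC, hB⟩ := realize_reading_rename ρ (hN r hr) hK hG hH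
    generalize r.rename ρ = R at *
    -- The witness of the reading may disturb variables outside the rule, so only its values on the
    -- local variables are used; freshness keeps `D`, `E` and the globals unaffected.
    let d : Var → N := fun x => if x ∈ R.localVars then b x else c x
    have hd : ∀ x ∉ R.localVars, d x = c x := fun x hx => by simp only [d, hx, if_false]
    have hdb : ∀ x ∈ R.fv, d x = b x := fun x hx => by
      by_cases hl : x ∈ R.localVars
      · simp only [d, hl, if_true]
      · rw [hd x hl, hb x ((Rule.mem_fv_iff.1 hx).resolve_right hl)]
    have hdDE : ∀ x ∈ userFv D ∪ E.fv, d x = c x := fun x hx =>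
      hd x fun h => Finset.disjoint_left.1 hfresh h hx
    refine ⟨d, fun x hx => ?_, BConj.holds_append.2 ⟨?_, BConj.holds_append.2 ⟨?_, ?_⟩⟩, ?_⟩
    · rw [hd x fun h => Finset.disjoint_left.1 hX h hx]
      exact hc x hx
    · exact (BConj.holds_congr fun x hx => hdb x (Finset.mem_union_right _
        (Finset.mem_union_left _ (Finset.mem_union_right _ hx)))).2 hC
    · exact (BConj.holds_congr fun x hx => hdb x (Finset.mem_union_right _
        (Finset.mem_union_left _ (Finset.mem_union_left _ hx)))).2 hG'
    · exact (BConj.holds_congr fun x hx => hdDE x (Finset.mem_union_right _ hx)).2 hE'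
    · have h₁ : groundStore d R.bodyUser = groundStore b R.bodyUser :=
        groundStore_congr fun x hx =>
          hdb x (Finset.mem_union_right _ (Finset.mem_union_right _ hx))
      have h₂ : groundStore d R.kept = groundStore c R.kept :=
        groundStore_congr fun x hx => hd x fun hl =>
          Finset.disjoint_left.1 R.disjoint_localVars_headFv hl (Finset.mem_union_left _ hx)
      have h₃ : groundStore d D = groundStore c D :=
        groundStore_congr fun x hx => hdDE x (Finset.mem_union_left _ hx)
      simp only [groundStore_add, Multiset.mem_add, or_imp, forall_and, h₁, h₂, h₃]
      exact ⟨⟨hB, hK⟩, hD⟩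
  | equiv h₁ _ h₂ ih => exact (h₂.sat_iff a).1 (ih ((h₁.sat_iff a).1 hσ))

theorem AbstractSteps.sat_atoms [Nonempty N] [N ⊨ CT] (hN : ∀ r ∈ P, r.reading.Realize N)
    {σ τ : State L U} (h : AbstractSteps CT P σ τ) {a : Var → N}
    (hσ : σ.Sat (fun A => ∀ x ∈ A, AtomHolds L x) a) :
    τ.Sat (fun A => ∀ x ∈ A, AtomHolds L x) a := by
  induction h with
  | single h => exact h.elim (·.sat_atoms hN hσ) fun h => (h.sat_iff a).1 hσ
  | tail _ h ih => exact h.elim (·.sat_atoms hN ih) fun h => (h.sat_iff a).1 ih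

end Reading

/-! ### Answers and the inductive semantics -/

section Semantics

variable {L : FirstOrder.Language.{u, v}} {U : ℕ → Type w} {CT : L.Theory} {P : Program L U}

theorem AbstractEquiv.globals_empty (E : BConj L) (hE : E.fv = ∅) (X : Finset Var) :
    AbstractEquiv CT (⟨0, E, ∅⟩ : State L U) ⟨0, E, X⟩ := by
  induction X using Finset.induction_on with
  | empty => exact .refl _
  | insert y X _ ih => exact ih.trans (.rel _ _ (.globals _ _ _ _ (by simp [hE, userFv])))

/-- An answer is equivalent to failure unless its constraints have a model. -/
theorem exists_model_of_not_failure {τ : State L U} (h : τ.store = 0)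
    (hf : ¬ AbstractEquiv CT (failure L U) τ) :
    ∃ (N : Theory.ModelType.{u, v, max u v} CT) (a : Var → N), τ.builtIn.Holds a := by
  by_contra! hN
  obtain ⟨D, E, X⟩ := τ
  obtain rfl : D = 0 := h
  refine hf ((AbstractEquiv.globals_empty [.falsum] (by simp [BConj.fv, BuiltIn.fv]) X).trans
    (.of_entails (fun N a ha => absurd ha BConj.not_holds_falsum)
      fun N a ha => absurd ha (hN N a)))

theorem not_equiv_failure {N : Type*} [L.Structure N] [Nonempty N] [N ⊨ CT] {τ : State L U}
    {Q : Multiset (GroundAtom U N) → Prop} {a : Var → N} (h : τ.Sat Q a) :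
    ¬ AbstractEquiv CT (failure L U) τ := fun hf => by
  obtain ⟨b, -, hb, -⟩ := (hf.sat_iff a).2 h
  exact BConj.not_holds_falsum hb

theorem mem_inductiveSemantics_iff {σ : State L U} :
    σ ∈ inductiveSemantics CT P ↔
      (∃ τ, AbstractStep CT P σ τ ∧ τ ∈ inductiveSemantics CT P) ∨
        (σ.store = 0 ∧ ¬ AbstractEquiv CT (failure L U) σ) := by
  have := (inductiveOperator CT P).map_lfp
  conv_lhs => rw [inductiveSemantics, ← this]
  rfl

theorem exists_answer_of_mem_inductiveSemantics {σ : State L U}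
    (h : σ ∈ inductiveSemantics CT P) :
    ∃ τ : State L U, AbstractSteps CT P σ τ ∧ τ.store = 0 ∧
      ¬ AbstractEquiv CT (failure L U) τ := by
  refine OrderHom.lfp_le (inductiveOperator CT P)
    (a := {σ | ∃ τ : State L U, AbstractSteps CT P σ τ ∧ τ.store = 0 ∧
      ¬ AbstractEquiv CT (failure L U) τ}) ?_ h
  rintro σ (⟨σ', hs, τ, hτ, h⟩ | ⟨h₁, h₂⟩)
  · exact ⟨τ, hs.steps.trans hτ, h⟩
  · exact ⟨σ, (AbstractEquiv.refl σ).steps, h₁, h₂⟩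

/-- Having an empty store is a syntactic condition, but for consistent states it is stable under
equivalence, because the satisfaction of `(· = 0)` is invariant. -/
theorem AbstractEquiv.mem_inductiveSemantics {σ τ : State L U} (h : AbstractEquiv CT σ τ)
    (hτ : τ ∈ inductiveSemantics CT P) : σ ∈ inductiveSemantics CT P := by
  rw [mem_inductiveSemantics_iff] at hτ ⊢
  rcases hτ with ⟨υ, hs, hυ⟩ | ⟨h₁, h₂⟩
  · exact .inl ⟨υ, .equiv h hs (.refl _), hυ⟩
  · refine .inr ⟨?_, fun hf => h₂ (hf.trans h)⟩
    obtain ⟨N, a, ha⟩ := exists_model_of_not_failure h₁ h₂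
    obtain ⟨b, -, -, hb⟩ := (h.sat_iff (Q := (· = 0)) a).2
      ⟨a, fun _ _ => rfl, ha, groundStore_eq_zero.2 h₁⟩
    exact groundStore_eq_zero.1 hb

theorem AbstractSteps.mem_inductiveSemantics {σ τ : State L U} (h : AbstractSteps CT P σ τ)
    (hτ : τ ∈ inductiveSemantics CT P) : σ ∈ inductiveSemantics CT P := by
  induction h using Relation.TransGen.head_induction_on with
  | single h =>
    exact h.elim (fun h => mem_inductiveSemantics_iff.2 (.inl ⟨_, h, hτ⟩))
      (·.mem_inductiveSemantics hτ)
  | head h _ ih =>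
    exact h.elim (fun h => mem_inductiveSemantics_iff.2 (.inl ⟨_, h, ih⟩))
      (·.mem_inductiveSemantics ih)

/-- The model is a model of the answer's built-ins expanded by removability. The instance of `D`
obtained by reading the derivation backwards vanishes as a whole, so each of its atoms is removable.
-/
theorem satisfiableWithin_of_answer (hP : IsConfluent CT P) {D : Multiset (UserConstraint L U)}
    {E : BConj L} {X : Finset Var} {τ : State L U} (h : AbstractSteps CT P ⟨D, E, X⟩ τ)
    (hτ : τ.store = 0) (hf : ¬ AbstractEquiv CT (failure L U) τ) :
    SatisfiableWithin CT P D E := by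
  obtain ⟨N, a, ha⟩ := exists_model_of_not_failure hτ hf
  obtain ⟨b, -, hbE, hbD⟩ := h.sat_vanishes (a := a) ⟨a, fun _ _ => rfl, ha, by
    rw [groundStore_eq_zero.2 hτ]; exact Relation.ReflTransGen.refl⟩
  let inst : (userLanguage.{u, w} U).Structure N :=
    ⟨fun f => PEmpty.elim f, fun {n} R xs => Removable P (⟨n, R, xs⟩ : GroundAtom U N)⟩
  have hatom : ∀ x : GroundAtom U N, AtomHolds L x ↔ Removable P x := fun x => Iff.rfl
  have hmodel : N ⊨ programTheory CT P ∪
      {Formula.exClosure (userConj D ⊓ builtInConj U E)} := by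
    refine Theory.model_iff _ |>.2 fun φ hφ => ?_
    rcases hφ with (hφ | ⟨r, hr, rfl⟩) | rfl
    · have : N ⊨ LHom.onTheory (LHom.sumInl : L →ᴸ fullLanguage L U) CT :=
        (LHom.onTheory_model _ _).2 inferInstance
      exact Theory.realize_sentence_of_mem _ hφ
    · rw [realize_reading]
      simp only [hatom]
      exact fun c hK hG => hP.removable_iff hr hK hG
    · rw [realize_exClosure_iff]
      refine ⟨b, ?_⟩
      rw [Formula.realize_inf, realize_userConj, realize_builtInConj]
      exact ⟨fun x hx => (hatom x).2 ⟨_, hx, hbD⟩, hbE⟩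
  exact Theory.Model.isSatisfiable N

/-- Truth travels forward to the given answer, excluding failure; membership travels back from
there. Confluence plays no role. -/
theorem mem_inductiveSemantics_of_satisfiableWithin {D : Multiset (UserConstraint L U)}
    {E : BConj L} {X : Finset Var} (hσ : HasAnswer CT P ⟨D, E, X⟩)
    (h : SatisfiableWithin CT P D E) :
    (⟨D, E, X⟩ : State L U) ∈ inductiveSemantics CT P := by
  obtain ⟨τ, hτ, hs⟩ := hσ
  obtain ⟨N⟩ := h
  let inst : L.Structure N := (LHom.sumInl : L →ᴸ fullLanguage L U).reduct N
  have hmem : ∀ φ ∈ programTheory CT P ∪ {Formula.exClosure (userConj D ⊓ builtInConj U E)},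
      Sentence.Realize N φ := fun φ hφ => Theory.realize_sentence_of_mem _ hφ
  have hCT : N ⊨ CT := (LHom.onTheory_model (LHom.sumInl : L →ᴸ fullLanguage L U) CT).1
    ((Theory.model_iff _).2 fun φ hφ => hmem φ (.inl (.inl hφ)))
  have hread : ∀ r ∈ P, r.reading.Realize N := fun r hr => hmem _ (.inl (.inr ⟨r, hr, rfl⟩))
  obtain ⟨a, ha⟩ := (realize_exClosure_iff _).1 (hmem _ (.inr rfl))
  rw [Formula.realize_inf, realize_userConj, realize_builtInConj] at ha
  have := hs.sat_atoms hread (a := a) ⟨a, fun _ _ => rfl, ha.2, ha.1⟩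
  exact hs.mem_inductiveSemantics (mem_inductiveSemantics_iff.2 (.inr ⟨hτ, not_equiv_failure this⟩))

end Semantics

end CHR

end

/-! ### The equivalence of membership and satisfiability -/

theorem mainTheorem3 {L : FirstOrder.Language.{u, v}} {U : ℕ → Type w}
    (CT : L.Theory) (hCT : ∀ φ ∈ CT, CHR.IsCoherent φ)
    (P : CHR.Program L U) (hP : CHR.IsConfluent CT P)
    (D : Multiset (CHR.UserConstraint L U)) (E : CHR.BConj L) (X : Finset CHR.Var)
    (hσ : CHR.HasAnswer CT P ⟨D, E, X⟩) :
    (⟨D, E, X⟩ : CHR.State L U) ∈ CHR.inductiveSemantics CT P ↔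
      CHR.SatisfiableWithin CT P D E := by
  constructor
  · intro h
    obtain ⟨τ, hs, hτ, hf⟩ := CHR.exists_answer_of_mem_inductiveSemantics h
    exact CHR.satisfiableWithin_of_answer hP hs hτ hf
  · exact CHR.mem_inductiveSemantics_of_satisfiableWithin hσ
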